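/- Let $f:\mathbb R^n\to\mathbb R$ be convex and $L$-smooth ($L>0$: $f$ is differentiable and $\|\nabla f(x)-\nabla f(y)\|_2\le L\|x-y\|_2$ for all $x,y$), with a minimizer $x^*$. Let $\xi\sim P$ and let $\nabla f(x,\xi)$, jointly measurable in $(x,\xi)$, be stochastic gradients with $\mathbb E_\xi[\nabla f(x,\xi)]=\nabla f(x)$ and $\mathbb E_\xi\|\nabla f(x,\xi)-\nabla f(x)\|_2^2\le\sigma^2$ for all $x$, where $\sigma\ge 0$; nothing else is assumed on their tails. Let $x^0\in\mathbb R^n$ with $R_0=\|x^0-x^*\|_2>0$. Given $N\ge1$, batch sizes $m_0,\dots,m_{N-1}$, $a>0$ and $B>0$, the method clipped-SSTM sets $A_0=\alpha_0=0$, $y^0=z^0=x^0$ and, for $k=0,\dots,N-1$, $$\alpha_{k+1}=\frac{k+2}{2aL},\quad A_{k+1}=A_k+\alpha_{k+1},\quad x^{k+1}=\frac{A_ky^k+\alpha_{k+1}z^k}{A_{k+1}},\quad g^{k+1}=\frac1{m_k}\sum_{i=1}^{m_k}\nabla f(x^{k+1},\xi_i^k),$$ $$z^{k+1}=z^k-\alpha_{k+1}\min\Big\{1,\frac{B}{\alpha_{k+1}\|g^{k+1}\|_2}\Big\}g^{k+1},\qquad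 y^{k+1}=\frac{A_ky^k+\alpha_{k+1}z^{k+1}}{A_{k+1}},$$ where all the samples $\xi_i^k$ are independent with law $P$ (and a vector $g^{k+1}=0$ is left unchanged by the clipping). It returns $y^N$ and makes $\sum_{k=0}^{N-1}m_k$ oracle calls. Put $C=\sqrt5$ and, for $\beta\in(0,1)$ and $N\ge1$, $$\hat a(N,\beta)=\max\Big\{1,\ \frac{16\ln\frac{4N}\beta}{C},\ 36\Big(2\ln\tfrac{4N}\beta+\sqrt{4\ln^2\tfrac{4N}\beta+2\ln\tfrac{4N}\beta}\Big)^2\Big\}.$$ The parameters of the method are always $$m_k=\Big\lceil\max\Big\{1,\frac{6000\sigma^2\alpha_{k+1}^2N\ln\frac{4N}\beta}{C^2R_0^2},\frac{10368\sigma^2\alpha_{k+1}^2N}{C^2R_0^2}\Big\}\Big\rceil,\qquad B=\frac{CR_0}{8\ln\frac{4N}\beta}.$$ **(i)** For all $\beta\in(0,1)$ and $N\ge1$ with $\ln\frac{4N}\beta\ge2$ and all $a\ge\hat a(N,\beta)$, after $N$ iterations of clipped-SSTM, with probability at least $1-\beta$, $$f(y^N)-f(x^*)\le\frac{2aLC^2R_0^2}{N(N+3)}.$$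 **(ii)** There is an absolute constant $K>0$ such that for all $L>0$, $\sigma\ge0$, $R_0>0$, $\beta\in(0,1)$ and $0<\varepsilon\le LR_0^2/2$ there is an $N\ge1$ with $\ln\frac{4N}\beta\ge2$, depending only on these five numbers, such that for every $n$ and every problem, stochastic gradient, starting point and minimizer as above, clipped-SSTM with $a=\hat a(N,\beta)$ satisfies $f(y^N)-f(x^*)\le\varepsilon$ with probability at least $1-\beta$, and $$N\le K\sqrt{\frac{LR_0^2}\varepsilon}\,\ln\frac{LR_0^2}{\varepsilon\beta},\qquad\sum_{k=0}^{N-1}m_k\le K\max\Big\{\sqrt{\frac{LR_0^2}\varepsilon},\frac{\sigma^2R_0^2}{\varepsilon^2}\Big\}\ln\frac{LR_0^2}{\varepsilon\beta}.$$ -/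

import Mathlib

open MeasureTheory ProbabilityTheory

namespace ClippedSSTM

noncomputable section

/-- `L`-smoothness on the whole space: `f` is differentiable and its gradient is
`L`-Lipschitz. -/
structure IsLSmooth {n : ℕ} (f : EuclideanSpace ℝ (Fin n) → ℝ) (L : ℝ) : Prop where
  differentiable : Differentiable ℝ f
  gradient_lipschitz : ∀ x y, ‖gradient f x - gradient f y‖ ≤ L * ‖x - y‖

/-- `g x ξ`, with `ξ` distributed according to `P`, is an unbiased stochastic gradient of `f`
whose variance is at most `σ ^ 2` at every point. -/
structure IsStochasticGradient {n : ℕ} {Ξ : Type*} [MeasurableSpace Ξ]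
    (f : EuclideanSpace ℝ (Fin n) → ℝ) (P : Measure Ξ)
    (g : EuclideanSpace ℝ (Fin n) → Ξ → EuclideanSpace ℝ (Fin n)) (σ : ℝ) : Prop where
  measurable : Measurable (Function.uncurry g)
  integrable : ∀ x, Integrable (g x) P
  unbiased : ∀ x, ∫ s, g x s ∂P = gradient f x
  integrable_sq : ∀ x, Integrable (fun s => ‖g x s - gradient f x‖ ^ 2) P
  variance_le : ∀ x, ∫ s, ‖g x s - gradient f x‖ ^ 2 ∂P ≤ σ ^ 2

/-- The random variables `ξ k i` (the `i`-th sample available at iteration `k`) are independent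
and all have law `P`. -/
structure IsIIDSample {Ω Ξ : Type*} [MeasurableSpace Ω] [MeasurableSpace Ξ]
    (μ : Measure Ω) (P : Measure Ξ) (ξ : ℕ → ℕ → Ω → Ξ) : Prop where
  measurable : ∀ k i, Measurable (ξ k i)
  law : ∀ k i, μ.map (ξ k i) = P
  indep : iIndepFun (fun p : ℕ × ℕ => ξ p.1 p.2) μ

/-! ### The algorithm -/

/-- Clipping: `clip v l = min {1, l / ‖v‖} v` (and `clip 0 l = 0`). -/
def clip {n : ℕ} (v : EuclideanSpace ℝ (Fin n)) (l : ℝ) : EuclideanSpace ℝ (Fin n) :=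
  min 1 (l / ‖v‖) • v

/-- The mini-batched stochastic gradient at `x` computed from the samples `s 0, …, s (m - 1)`. -/
def miniBatch {n : ℕ} {Ξ : Type*}
    (g : EuclideanSpace ℝ (Fin n) → Ξ → EuclideanSpace ℝ (Fin n))
    (m : ℕ) (s : ℕ → Ξ) (x : EuclideanSpace ℝ (Fin n)) : EuclideanSpace ℝ (Fin n) :=
  (1 / (m : ℝ)) • ∑ i ∈ Finset.range m, g x (s i)

/-- `α₀ = 0` and `α_{k+1} = (k + 2) / (2 a L)`. -/
def alpha (a L : ℝ) : ℕ → ℝ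
  | 0 => 0
  | k + 1 => ((k : ℝ) + 2) / (2 * a * L)

/-- `A₀ = 0` and `A_{k+1} = A_k + α_{k+1}`. -/
def bigA (a L : ℝ) : ℕ → ℝ
  | 0 => 0
  | k + 1 => bigA a L k + alpha a L (k + 1)

/-- The pair `(y^k, z^k)` kept by the method between two iterations. -/
structure State (n : ℕ) where
  y : EuclideanSpace ℝ (Fin n)
  z : EuclideanSpace ℝ (Fin n)

/-- One iteration of clipped-SSTM, from `(y^k, z^k)` to `(y^{k+1}, z^{k+1})`, with batch size `m`,
samples `s 0, …, s (m - 1)` and clipping level `λ_{k+1} = B / α_{k+1}`. -/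
def step {n : ℕ} {Ξ : Type*}
    (g : EuclideanSpace ℝ (Fin n) → Ξ → EuclideanSpace ℝ (Fin n))
    (a L B : ℝ) (k m : ℕ) (s : ℕ → Ξ) (S : State n) : State n :=
  let x := (1 / bigA a L (k + 1)) • (bigA a L k • S.y + alpha a L (k + 1) • S.z)
  let z' := S.z - alpha a L (k + 1) • clip (miniBatch g m s x) (B / alpha a L (k + 1))
  { y := (1 / bigA a L (k + 1)) • (bigA a L k • S.y + alpha a L (k + 1) • z')
    z := z' }

/-- The state of clipped-SSTM after `k` iterations from `x0`, with batch sizes `m`, stepsize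
parameter `a`, smoothness constant `L` and clipping parameter `B`, where `s k i` is the `i`-th
sample drawn at iteration `k`. -/
def run {n : ℕ} {Ξ : Type*}
    (g : EuclideanSpace ℝ (Fin n) → Ξ → EuclideanSpace ℝ (Fin n))
    (x0 : EuclideanSpace ℝ (Fin n)) (a L B : ℝ) (m : ℕ → ℕ) (s : ℕ → ℕ → Ξ) : ℕ → State n
  | 0 => { y := x0, z := x0 }
  | k + 1 => step g a L B k (m k) (s k) (run g x0 a L B m s k)

/-- The number of stochastic gradients evaluated during the first `N` iterations. -/
def oracleCalls (m : ℕ → ℕ) (N : ℕ) : ℕ := ∑ k ∈ Finset.range N, m k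

/-! ### The parameters -/

/-- The constant `C = √5`. -/
def constC : ℝ := √5

/-- `ln (4 N / β)`. -/
def logFactor (N : ℕ) (β : ℝ) : ℝ := Real.log (4 * (N : ℝ) / β)

/-- The clipping parameter `B = C R₀ / (8 ln (4 N / β))`. -/
def clipParam (R0 β : ℝ) (N : ℕ) : ℝ := constC * R0 / (8 * logFactor N β)

/-- The lower bound on the stepsize parameter `a`. -/
def aMin (β : ℝ) (N : ℕ) : ℝ :=
  max 1 (max (16 * logFactor N β / constC)
    (36 * (2 * logFactor N β + √(4 * logFactor N β ^ 2 + 2 * logFactor N β)) ^ 2))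

/-- The batch sizes `m_k`, rounded up to an integer. -/
def batchSize (L σ R0 a β : ℝ) (N k : ℕ) : ℕ :=
  ⌈max 1 (max
    (6000 * σ ^ 2 * alpha a L (k + 1) ^ 2 * (N : ℝ) * logFactor N β / (constC ^ 2 * R0 ^ 2))
    (10368 * σ ^ 2 * alpha a L (k + 1) ^ 2 * (N : ℝ) / (constC ^ 2 * R0 ^ 2)))⌉₊

/-- The output `y^N` of clipped-SSTM run for `N` iterations with the batch sizes and the clipping
parameter above. -/
def output {n : ℕ} {Ξ : Type*}
    (g : EuclideanSpace ℝ (Fin n) → Ξ → EuclideanSpace ℝ (Fin n))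
    (x0 : EuclideanSpace ℝ (Fin n)) (L σ R0 a β : ℝ) (N : ℕ) (s : ℕ → ℕ → Ξ) :
    EuclideanSpace ℝ (Fin n) :=
  (run g x0 a L (clipParam R0 β N) (batchSize L σ R0 a β N) s N).y

end

end ClippedSSTM

namespace ClippedSSTM

/-! ### Convexity and smoothness -/

section Smooth

variable {E : Type*} [NormedAddCommGroup E] [InnerProductSpace ℝ E] [CompleteSpace E]

/-! Write l = ln(4N/β) and D = C R₀, so D² = 5R₀² and B = D/(8l). The potential A_k (f(y^k) -
f(x^*)) + ‖z^k - x^*‖²/2 would not increase with exact gradients; with the clipped gradient it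
increases by at most a noise term in the scaled error θ = α_{k+1}(clip g^{k+1} - ∇f(x^{k+1}))
(`potential_step_le`).

The noise is summed only while its sum W is at most T = 2R₀². Until then the potential is at most
R₀²/2 + T = D²/2, so y^k and z^k lie within D of x^* (`potential_run_le`), and the lower bound on a
forces α_{k+1}‖∇f(x^{k+1})‖ ≤ B/2 (`alpha_mul_norm_gradient_le`). The true gradient is then at most
half the clipping level, which makes θ bounded by 3B/2, with second moment at most the mini-batch
variance (times α²) and mean at most that quantity over 2B (`scaledError_moments`). No tail
assumption is needed.

A Bernstein-type estimate then bounds the conditional expectation of exp(s · noise), s = 4l/D², by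
exp(l/(100N)) (`lintegral_exp_noiseTerm_le`). Multiplying over the N iterations, with fresh samples
independent of the past, gives E exp(sW) ≤ exp(l/100). Markov's inequality yields P(W > 2R₀²) ≤
e^{-l} = β/(4N), and outside this event A_N (f(y^N) - f(x^*)) ≤ 5R₀²/2. Because W freezes once it
passes T, this single event controls all iterations and no union bound is needed.

For the complexity, a is of order l², so N of order √X ln(X/β) with X = LR₀²/ε suffices; l and
ln(X/β) are then comparable. -/

lemma hasDerivAt_comp_line {f : E → ℝ} (hf : Differentiable ℝ f) (x v : E) (t : ℝ) :
    HasDerivAt (fun t : ℝ => f (x + t • v)) (inner ℝ (gradient f (x + t • v)) v) t := by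
  have h1 : HasDerivAt (fun t : ℝ => x + t • v) v t := by
    simpa using ((hasDerivAt_id t).smul_const v).const_add x
  have h2 := ((hf (x + t • v)).hasFDerivAt).comp_hasDerivAt t h1
  rw [inner_gradient_left]
  exact h2

/-- The first-order characterization of convexity. -/
lemma _root_.ConvexOn.add_inner_gradient_le {f : E → ℝ} (hc : ConvexOn ℝ Set.univ f)
    (hf : Differentiable ℝ f) (x y : E) :
    f x + inner ℝ (gradient f x) (y - x) ≤ f y := by
  have hφ : ConvexOn ℝ Set.univ (fun t : ℝ => f (x + t • (y - x))) := by
    have := hc.comp_affineMap (AffineMap.lineMap x y : ℝ →ᵃ[ℝ] E)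
    refine ConvexOn.congr (by simpa using this) fun t _ => ?_
    simp [AffineMap.lineMap_apply, add_comm]
  have hd := hasDerivAt_comp_line hf x (y - x) 0
  have := hφ.le_slope_of_hasDerivAt (Set.mem_univ 0) (Set.mem_univ 1) one_pos hd
  simp [slope_def_field, -inner_gradient_left] at this
  linarith

/-- The descent lemma for functions with Lipschitz gradient. -/
lemma le_quadratic_upper_bound {f : E → ℝ} {L : ℝ} (hf : Differentiable ℝ f)
    (hL : ∀ x y, ‖gradient f x - gradient f y‖ ≤ L * ‖x - y‖) (x y : E) :
    f y ≤ f x + inner ℝ (gradient f x) (y - x) + L / 2 * ‖y - x‖ ^ 2 := by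
  set v := y - x with hv
  -- Subtracting the quadratic upper model along the segment leaves a function whose derivative is
  -- nonpositive on [0, 1] by Cauchy-Schwarz and the Lipschitz bound.
  have hd : ∀ t : ℝ, HasDerivAt
      (fun t : ℝ => f (x + t • v) - t * inner ℝ (gradient f x) v - L / 2 * t ^ 2 * ‖v‖ ^ 2)
      (inner ℝ (gradient f (x + t • v)) v - inner ℝ (gradient f x) v - L * t * ‖v‖ ^ 2) t := by
    intro t
    have h1 := hasDerivAt_comp_line hf x v t
    have h2 := (hasDerivAt_id t).mul_const (inner ℝ (gradient f x) v)
    have h3 := (((hasDerivAt_id t).pow 2).const_mul (L / 2)).mul_const (‖v‖ ^ 2)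
    refine ((h1.sub h2).sub h3).congr_deriv ?_
    simp only [id, Nat.cast_ofNat]
    ring
  have hanti := antitoneOn_of_deriv_nonpos (convex_Icc (0 : ℝ) 1)
    (fun t _ => (hd t).continuousAt.continuousWithinAt)
    (fun t _ => (hd t).differentiableAt.differentiableWithinAt)
    (fun t ht => by
      rw [interior_Icc] at ht
      rw [(hd t).deriv, ← inner_sub_left]
      have h1 := real_inner_le_norm (gradient f (x + t • v) - gradient f x) v
      have h2 := hL (x + t • v) x
      rw [add_sub_cancel_left, norm_smul, Real.norm_of_nonneg ht.1.le] at h2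
      nlinarith [mul_le_mul_of_nonneg_right h2 (norm_nonneg v)])
  have h := hanti (Set.left_mem_Icc.2 zero_le_one) (Set.right_mem_Icc.2 zero_le_one) zero_le_one
  have hxy : x + v = y := by rw [hv]; abel
  simp [hxy, -inner_gradient_left] at h
  linarith

/-- A gradient step of length 1/L lowers f by at least ‖∇f(x)‖²/(2L), and cannot go below the
minimum. -/
lemma sq_norm_gradient_le {f : E → ℝ} {L : ℝ} (hL0 : 0 < L) (hf : Differentiable ℝ f)
    (hL : ∀ x y, ‖gradient f x - gradient f y‖ ≤ L * ‖x - y‖) {xstar : E}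
    (hmin : IsMinOn f Set.univ xstar) (x : E) :
    ‖gradient f x‖ ^ 2 ≤ 2 * L * (f x - f xstar) := by
  have h1 := le_quadratic_upper_bound hf hL x (x - (1 / L) • gradient f x)
  have h2 : f xstar ≤ f (x - (1 / L) • gradient f x) := hmin (Set.mem_univ _)
  have h3 : x - (1 / L) • gradient f x - x = -((1 / L) • gradient f x) := by abel
  rw [h3, inner_neg_right, inner_smul_right, real_inner_self_eq_norm_sq, norm_neg, norm_smul,
    Real.norm_of_nonneg (by positivity)] at h1
  have h4 : 2 * L * (f x - (1 / L) * ‖gradient f x‖ ^ 2 + L / 2 * (1 / L * ‖gradient f x‖) ^ 2)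
      = 2 * L * f x - ‖gradient f x‖ ^ 2 := by
    field_simp; ring
  nlinarith

lemma gradient_eq_zero_of_isMinOn {f : E → ℝ} {xstar : E} (hmin : IsMinOn f Set.univ xstar) :
    gradient f xstar = 0 := by
  have : IsLocalMin f xstar := hmin.isLocalMin Filter.univ_mem
  rw [gradient, this.fderiv_eq_zero, map_zero]

end Smooth

/-! ### Clipping -/

section Clip

variable {n : ℕ}

lemma clip_of_norm_le {v : EuclideanSpace ℝ (Fin n)} {l : ℝ} (h : ‖v‖ ≤ l) : clip v l = v := by
  rcases eq_or_ne v 0 with rfl | hv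
  · simp [clip]
  · rw [clip, min_eq_left, one_smul]
    rwa [one_le_div (norm_pos_iff.2 hv)]

lemma clip_of_lt_norm {v : EuclideanSpace ℝ (Fin n)} {l : ℝ} (hl : 0 ≤ l) (h : l < ‖v‖) :
    clip v l = (l / ‖v‖) • v := by
  rw [clip, min_eq_right]
  exact (div_le_one (hl.trans_lt h)).2 h.le

lemma norm_clip_le (v : EuclideanSpace ℝ (Fin n)) {l : ℝ} (hl : 0 ≤ l) : ‖clip v l‖ ≤ l := by
  rcases le_or_gt ‖v‖ l with h | h
  · rwa [clip_of_norm_le h]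
  · have hv : 0 < ‖v‖ := hl.trans_lt h
    rw [clip_of_lt_norm hl h, norm_smul, Real.norm_of_nonneg (by positivity),
      div_mul_cancel₀ _ hv.ne']

/-- Clipping is the projection onto the ball of radius l, which contains d. It is what lets the
clipped gradient inherit the mini-batch variance. -/
lemma norm_clip_sub_le {v d : EuclideanSpace ℝ (Fin n)} {l : ℝ} (hd : ‖d‖ ≤ l) :
    ‖clip v l - d‖ ≤ ‖v - d‖ := by
  have hl : 0 ≤ l := (norm_nonneg d).trans hd
  rcases le_or_gt ‖v‖ l with h | h
  · rw [clip_of_norm_le h]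
  · have hv : 0 < ‖v‖ := hl.trans_lt h
    rw [clip_of_lt_norm hl h]
    set c := l / ‖v‖ with hc
    have hcv : c * ‖v‖ = l := div_mul_cancel₀ _ hv.ne'
    have hc1 : c ≤ 1 := (div_le_one hv).2 h.le
    have hin : inner ℝ v d ≤ c * ‖v‖ ^ 2 := by
      have := real_inner_le_norm v d
      nlinarith [mul_le_mul_of_nonneg_left hd hv.le]
    refine le_of_sq_le_sq ?_ (norm_nonneg _)
    rw [norm_sub_sq_real, norm_sub_sq_real, norm_smul, inner_smul_left, mul_pow,
      Real.norm_eq_abs, sq_abs]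
    simp only [conj_trivial]
    nlinarith [mul_nonneg (sub_nonneg.2 hc1) (sub_nonneg.2 hin),
      mul_nonneg (sq_nonneg (1 - c)) (sq_nonneg ‖v‖)]

/-- With t = ‖v - d‖, clipping removes at most ‖v‖ - l ≤ t - l/2, and t - l/2 ≤ t²/(2l) because (t -
l)² ≥ 0. Being quadratic in t, this bounds the clipping bias by a variance. -/
lemma norm_clip_sub_self_le {v d : EuclideanSpace ℝ (Fin n)} {l : ℝ} (hl : 0 < l)
    (hd : ‖d‖ ≤ l / 2) : ‖clip v l - v‖ ≤ ‖v - d‖ ^ 2 / (2 * l) := by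
  rcases le_or_gt ‖v‖ l with h | h
  · rw [clip_of_norm_le h, sub_self, norm_zero]
    positivity
  · have hv : 0 < ‖v‖ := hl.trans h
    have h1 : clip v l - v = -((1 - l / ‖v‖) • v) := by
      rw [clip_of_lt_norm hl.le h, sub_smul, one_smul, neg_sub]
    rw [h1, norm_neg, norm_smul, Real.norm_of_nonneg (sub_nonneg.2 ((div_le_one hv).2 h.le)),
      sub_mul, div_mul_cancel₀ _ hv.ne', one_mul, le_div_iff₀ (by positivity)]
    have h2 : ‖v‖ - ‖d‖ ≤ ‖v - d‖ := norm_sub_norm_le v d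
    nlinarith [sq_nonneg (‖v - d‖ - l)]

end Clip

/-! ### The deterministic analysis -/

lemma bigA_eq (a L : ℝ) (k : ℕ) : bigA a L k = (k : ℝ) * (k + 3) / (4 * a * L) := by
  induction k with
  | zero => simp [bigA]
  | succ k ih =>
    rw [bigA, ih, alpha]
    rcases eq_or_ne (a * L) 0 with h | h
    · simp [mul_assoc, h]
    · have ha := left_ne_zero_of_mul h
      have hL := right_ne_zero_of_mul h
      push_cast
      field_simp
      ring

lemma alpha_succ_pos {a L : ℝ} (ha : 0 < a) (hL : 0 < L) (k : ℕ) : 0 < alpha a L (k + 1) := by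
  rw [alpha]; positivity

lemma bigA_nonneg {a L : ℝ} (ha : 0 < a) (hL : 0 < L) (k : ℕ) : 0 ≤ bigA a L k := by
  rw [bigA_eq]; positivity

lemma bigA_succ_pos {a L : ℝ} (ha : 0 < a) (hL : 0 < L) (k : ℕ) : 0 < bigA a L (k + 1) := by
  rw [bigA_eq]; positivity

/-- After clearing denominators this is (k+2)² ≤ (k+1)(k+4), an equality at k = 0. -/
lemma mul_sq_alpha_le_bigA {a L : ℝ} (ha : 0 < a) (hL : 0 < L) (k : ℕ) :
    a * L * alpha a L (k + 1) ^ 2 ≤ bigA a L (k + 1) := by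
  rw [bigA_eq, alpha]
  push_cast
  rw [div_pow, ← mul_div_assoc, div_le_div_iff₀ (by positivity) (by positivity)]
  have : 0 ≤ (a * L) ^ 2 * (k : ℝ) := by positivity
  nlinarith

/-! ### One accelerated step -/

section Step

variable {E : Type*} [NormedAddCommGroup E] [InnerProductSpace ℝ E]

/-- The effect on the potential of one accelerated step along an arbitrary vector `G`. -/
lemma potential_step_le [CompleteSpace E] {f : E → ℝ} {L : ℝ} (hc : ConvexOn ℝ Set.univ f)
    (hf : Differentiable ℝ f) (hL : ∀ x y, ‖gradient f x - gradient f y‖ ≤ L * ‖x - y‖)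
    {A α : ℝ} (hA : 0 ≤ A) (hα : 0 < α) (hαA : L * α ^ 2 ≤ A + α) {x y z y' z' G : E}
    (xstar : E)
    (hx : x = (1 / (A + α)) • (A • y + α • z)) (hz' : z' = z - α • G)
    (hy' : y' = (1 / (A + α)) • (A • y + α • z')) :
    (A + α) * (f y' - f xstar) + ‖z' - xstar‖ ^ 2 / 2 ≤
      A * (f y - f xstar) + ‖z - xstar‖ ^ 2 / 2 +
        (inner ℝ (α • (G - gradient f x)) (xstar - z + α • gradient f x) +
          ‖α • (G - gradient f x)‖ ^ 2) := by
  set d := gradient f x with hd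
  have hA' : 0 < A + α := by linarith
  have e1 : y' - x = -((α ^ 2 / (A + α)) • G) := by
    rw [hy', hx, hz']
    module
  -- This makes the convexity inequalities at y and x^*, weighted by A and α, combine into one where
  -- only ⟨d, z - x^*⟩ survives.
  have e2 : A • (y - x) + α • (z - x) = 0 := by
    have : (A + α) • x = A • y + α • z := by
      rw [hx, smul_smul, mul_one_div_cancel hA'.ne', one_smul]
    rw [smul_sub, smul_sub, sub_add_sub_comm, ← add_smul, this, sub_self]
  have e3 : A * inner ℝ d (y - x) + α * inner ℝ d (z - x) = 0 := by
    rw [← inner_smul_right, ← inner_smul_right, ← inner_add_right, e2, inner_zero_right]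
  have e4 : inner ℝ d (xstar - x) = inner ℝ d (z - x) - inner ℝ d (z - xstar) := by
    rw [← inner_sub_right]; congr 1; abel
  have h1 := le_quadratic_upper_bound hf hL x y'
  have h2 := mul_le_mul_of_nonneg_left (hc.add_inner_gradient_le hf x y) hA
  have h3 := mul_le_mul_of_nonneg_left (hc.add_inner_gradient_le hf x xstar) hα.le
  rw [← hd] at h1 h2 h3
  rw [e1, inner_neg_right, inner_smul_right, norm_neg, norm_smul, Real.norm_of_nonneg
    (by positivity)] at h1
  have h4 : (A + α) * (f x + -(α ^ 2 / (A + α) * inner ℝ d G) +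
      L / 2 * (α ^ 2 / (A + α) * ‖G‖) ^ 2) ≤
      (A + α) * f x - α ^ 2 * inner ℝ d G + α ^ 2 / 2 * ‖G‖ ^ 2 := by
    have : (A + α) * (f x + -(α ^ 2 / (A + α) * inner ℝ d G) +
        L / 2 * (α ^ 2 / (A + α) * ‖G‖) ^ 2) = (A + α) * f x - α ^ 2 * inner ℝ d G +
        (L * α ^ 2 / (A + α)) * (α ^ 2 / 2 * ‖G‖ ^ 2) := by
      field_simp
      ring
    rw [this]
    have h5 : L * α ^ 2 / (A + α) ≤ 1 := (div_le_one hA').2 hαA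
    have := mul_le_mul_of_nonneg_right h5 (show 0 ≤ α ^ 2 / 2 * ‖G‖ ^ 2 by positivity)
    linarith
  have h5 := mul_le_mul_of_nonneg_left h1 hA'.le
  have e5 : ‖z' - xstar‖ ^ 2 = ‖z - xstar‖ ^ 2 - 2 * α * inner ℝ G (z - xstar) +
      α ^ 2 * ‖G‖ ^ 2 := by
    rw [hz', sub_right_comm, norm_sub_sq_real, inner_smul_right, norm_smul, mul_pow,
      Real.norm_eq_abs, sq_abs, real_inner_comm G]
    ring
  -- The right side is what remains after adding the descent and convexity inequalities to the
  -- expansion of ‖z' - x^*‖²/2; the descent lemma and that expansion each supply half of α²‖G‖². It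
  -- vanishes when G = d.
  have e6 : inner ℝ (α • (G - d)) (xstar - z + α • d) + ‖α • (G - d)‖ ^ 2 =
      -α * inner ℝ G (z - xstar) + α * inner ℝ d (z - xstar) + α ^ 2 * ‖G‖ ^ 2 -
        α ^ 2 * inner ℝ d G := by
    rw [← neg_sub z xstar, norm_smul, mul_pow, norm_sub_sq_real, Real.norm_eq_abs, sq_abs,
      inner_smul_left, inner_add_right, inner_neg_right, inner_smul_right, inner_sub_left,
      inner_sub_left, real_inner_self_eq_norm_sq, real_inner_comm G d]
    simp only [conj_trivial]
    ring
  rw [e5, e6]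
  rw [e4] at h3
  linarith

lemma norm_convex_comb_sub_le {A α D : ℝ} (hA : 0 ≤ A) (hα : 0 < α) {y z c : E}
    (hy : ‖y - c‖ ≤ D) (hz : ‖z - c‖ ≤ D) :
    ‖(1 / (A + α)) • (A • y + α • z) - c‖ ≤ D := by
  have hA' : 0 < A + α := by linarith
  have e : (1 / (A + α)) • (A • y + α • z) - c =
      (1 / (A + α)) • (A • (y - c) + α • (z - c)) := by
    have : c = (1 / (A + α)) • ((A + α) • c) := by
      rw [smul_smul, one_div_mul_cancel hA'.ne', one_smul]
    nth_rewrite 1 [this]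
    rw [← smul_sub]
    congr 1
    module
  rw [e, norm_smul, Real.norm_of_nonneg (by positivity), one_div, inv_mul_le_iff₀ hA']
  calc _ ≤ ‖A • (y - c)‖ + ‖α • (z - c)‖ := norm_add_le _ _
    _ = A * ‖y - c‖ + α * ‖z - c‖ := by
      rw [norm_smul, norm_smul, Real.norm_of_nonneg hA, Real.norm_of_nonneg hα.le]
    _ ≤ _ := by nlinarith

end Step

/-! ### The noise terms along a run -/

noncomputable section

variable {n : ℕ} {Ξ : Type*}

/-- The point `x^{k+1}` at which the gradient is sampled, from `(y^k, z^k)`. -/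
def queryPoint (a L : ℝ) (k : ℕ) (y z : EuclideanSpace ℝ (Fin n)) : EuclideanSpace ℝ (Fin n) :=
  (1 / bigA a L (k + 1)) • (bigA a L k • y + alpha a L (k + 1) • z)

/-- The scaled error `α_{k+1} (clip g^{k+1} - ∇f(x^{k+1}))` of the clipped gradient. -/
def scaledError (f : EuclideanSpace ℝ (Fin n) → ℝ)
    (g : EuclideanSpace ℝ (Fin n) → Ξ → EuclideanSpace ℝ (Fin n)) (a L B : ℝ) (k m : ℕ)
    (x : EuclideanSpace ℝ (Fin n)) (s : ℕ → Ξ) : EuclideanSpace ℝ (Fin n) :=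
  alpha a L (k + 1) • (clip (miniBatch g m s x) (B / alpha a L (k + 1)) - gradient f x)

/-- The largest amount by which the error of the clipped gradient can increase the potential
`A_k (f(y^k) - f(x^*)) + ‖z^k - x^*‖² / 2` in iteration `k`. -/
def noiseTerm (f : EuclideanSpace ℝ (Fin n) → ℝ)
    (g : EuclideanSpace ℝ (Fin n) → Ξ → EuclideanSpace ℝ (Fin n))
    (xstar : EuclideanSpace ℝ (Fin n)) (a L B : ℝ) (k m : ℕ)
    (y z : EuclideanSpace ℝ (Fin n)) (s : ℕ → Ξ) : ℝ :=
  inner ℝ (scaledError f g a L B k m (queryPoint a L k y z) s)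
    (xstar - z + alpha a L (k + 1) • gradient f (queryPoint a L k y z)) +
  ‖scaledError f g a L B k m (queryPoint a L k y z) s‖ ^ 2

/-- The accumulated noise terms, stopped when their sum exceeds `T`. -/
def stoppedNoise (f : EuclideanSpace ℝ (Fin n) → ℝ)
    (g : EuclideanSpace ℝ (Fin n) → Ξ → EuclideanSpace ℝ (Fin n))
    (xstar x0 : EuclideanSpace ℝ (Fin n)) (a L B T : ℝ) (m : ℕ → ℕ) (s : ℕ → ℕ → Ξ) : ℕ → ℝ
  | 0 => 0
  | k + 1 => stoppedNoise f g xstar x0 a L B T m s k +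
      if stoppedNoise f g xstar x0 a L B T m s k ≤ T then
        noiseTerm f g xstar a L B k (m k) (run g x0 a L B m s k).y (run g x0 a L B m s k).z (s k)
      else 0

section Deterministic

variable {f : EuclideanSpace ℝ (Fin n) → ℝ}
  {g : EuclideanSpace ℝ (Fin n) → Ξ → EuclideanSpace ℝ (Fin n)}
  {xstar x0 : EuclideanSpace ℝ (Fin n)} {a L B T D R0 : ℝ} {m : ℕ → ℕ} {s : ℕ → ℕ → Ξ}

lemma potential_run_succ_le (hc : ConvexOn ℝ Set.univ f) (hs : IsLSmooth f L) (hL : 0 < L)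
    (ha : 1 ≤ a) (k : ℕ) :
    bigA a L (k + 1) * (f (run g x0 a L B m s (k + 1)).y - f xstar) +
        ‖(run g x0 a L B m s (k + 1)).z - xstar‖ ^ 2 / 2 ≤
      bigA a L k * (f (run g x0 a L B m s k).y - f xstar) +
        ‖(run g x0 a L B m s k).z - xstar‖ ^ 2 / 2 +
        noiseTerm f g xstar a L B k (m k) (run g x0 a L B m s k).y
          (run g x0 a L B m s k).z (s k) := by
  have ha0 : 0 < a := by linarith
  have hα := alpha_succ_pos ha0 hL k
  have hαA : L * alpha a L (k + 1) ^ 2 ≤ bigA a L k + alpha a L (k + 1) := by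
    have h1 := mul_sq_alpha_le_bigA ha0 hL k
    have h2 : 0 ≤ L * alpha a L (k + 1) ^ 2 := by positivity
    rw [bigA] at h1
    nlinarith
  exact potential_step_le hc hs.differentiable hs.gradient_lipschitz (bigA_nonneg ha0 hL k) hα hαA
    xstar rfl rfl rfl

/-- As long as the accumulated noise stays below `T`, the iterates stay in a fixed ball and the
potential is controlled. -/
lemma potential_run_le (hc : ConvexOn ℝ Set.univ f) (hs : IsLSmooth f L) (hL : 0 < L)
    (ha : 1 ≤ a) (hmin : IsMinOn f Set.univ xstar) (hR : ‖x0 - xstar‖ = R0) (hT : 0 ≤ T)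
    (hD0 : 0 ≤ D) (hD : R0 ^ 2 + 2 * T ≤ D ^ 2) (k : ℕ)
    (hk : stoppedNoise f g xstar x0 a L B T m s k ≤ T) :
    bigA a L k * (f (run g x0 a L B m s k).y - f xstar) +
        ‖(run g x0 a L B m s k).z - xstar‖ ^ 2 / 2 ≤
      R0 ^ 2 / 2 + stoppedNoise f g xstar x0 a L B T m s k ∧
    ‖(run g x0 a L B m s k).y - xstar‖ ≤ D ∧ ‖(run g x0 a L B m s k).z - xstar‖ ≤ D := by
  have ha0 : 0 < a := by linarith
  induction k with
  | zero =>
    have hRD : ‖x0 - xstar‖ ≤ D := le_of_sq_le_sq (by rw [hR]; linarith) hD0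
    refine ⟨?_, hRD, hRD⟩
    simp [run, bigA, stoppedNoise, hR]
  | succ k ih =>
    -- The sum freezes once above T, so being at most T now means it was so at every earlier time.
    have hk' : stoppedNoise f g xstar x0 a L B T m s k ≤ T := by
      by_contra h
      rw [stoppedNoise, if_neg h, add_zero] at hk
      exact h hk
    obtain ⟨h1, h2, h3⟩ := ih hk'
    have h4 := potential_run_succ_le (g := g) (x0 := x0) (xstar := xstar) (B := B) (m := m)
      (s := s) hc hs hL ha k
    have h5 : bigA a L (k + 1) * (f (run g x0 a L B m s (k + 1)).y - f xstar) +
        ‖(run g x0 a L B m s (k + 1)).z - xstar‖ ^ 2 / 2 ≤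
        R0 ^ 2 / 2 + stoppedNoise f g xstar x0 a L B T m s (k + 1) := by
      rw [stoppedNoise, if_pos hk']
      linarith
    have h6 : ‖(run g x0 a L B m s (k + 1)).z - xstar‖ ≤ D := by
      refine le_of_sq_le_sq ?_ hD0
      have : 0 ≤ bigA a L (k + 1) * (f (run g x0 a L B m s (k + 1)).y - f xstar) :=
        mul_nonneg (bigA_nonneg ha0 hL _) (sub_nonneg.2 (hmin (Set.mem_univ _)))
      linarith
    exact ⟨h5, norm_convex_comb_sub_le (bigA_nonneg ha0 hL k) (alpha_succ_pos ha0 hL k) h2 h6, h6⟩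

/-- The gradient at x^{k+1} is compared with the one at y^k, whose norm the function gap controls.
The target D/(16l) is half of B = D/(8l). -/
lemma alpha_mul_norm_gradient_le (hs : IsLSmooth f L) (hL : 0 < L)
    (hmin : IsMinOn f Set.univ xstar) {l : ℝ} (hl : 2 ≤ l)
    (ha : 36 * (2 * l + √(4 * l ^ 2 + 2 * l)) ^ 2 ≤ a) (k : ℕ)
    {y z : EuclideanSpace ℝ (Fin n)} (hy : ‖y - xstar‖ ≤ D) (hz : ‖z - xstar‖ ≤ D)
    (hf : bigA a L k * (f y - f xstar) ≤ D ^ 2 / 2) :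
    alpha a L (k + 1) * ‖gradient f (queryPoint a L k y z)‖ ≤ D / (16 * l) := by
  have hD : 0 ≤ D := (norm_nonneg _).trans hy
  have hq : 0 ≤ √(4 * l ^ 2 + 2 * l) := Real.sqrt_nonneg _
  have hq2 : √(4 * l ^ 2 + 2 * l) ^ 2 = 4 * l ^ 2 + 2 * l := Real.sq_sqrt (by positivity)
  set q := √(4 * l ^ 2 + 2 * l) with hqdef
  have ha0 : 0 < a := lt_of_lt_of_le (by positivity) ha
  have hu0 : 0 < √a := Real.sqrt_pos.2 ha0
  have hu2 : √a ^ 2 = a := Real.sq_sqrt ha0.le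
  have hu : 6 * (2 * l + q) ≤ √a := Real.le_sqrt_of_sq_le (by linarith [mul_pow 6 (2 * l + q) 2])
  set u := √a with hudef
  -- The number 6(2l + q) is the larger root of u² = 24lu + 72l; this is where the form of the lower
  -- bound on a comes from.
  have hkey : 24 * l * u + 72 * l ≤ u ^ 2 := by
    nlinarith [mul_self_le_mul_self (by positivity : 0 ≤ 6 * q) (by linarith : 6 * q ≤ u - 12 * l)]
  have hα := alpha_succ_pos ha0 hL k
  have hA' := bigA_succ_pos ha0 hL k
  have hA := bigA_nonneg ha0 hL k
  have hαA := mul_sq_alpha_le_bigA ha0 hL k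
  set x := queryPoint a L k y z with hx
  have hgrad0 : gradient f xstar = 0 := gradient_eq_zero_of_isMinOn hmin
  have hbound : D * (2 / u ^ 2 + 3 / (2 * u)) ≤ D / (16 * l) := by
    rw [div_eq_mul_inv D]
    refine mul_le_mul_of_nonneg_left ?_ hD
    rw [inv_eq_one_div, div_add_div _ _ (by positivity) (by positivity),
      div_le_div_iff₀ (by positivity) (by positivity)]
    have := mul_le_mul_of_nonneg_left hkey hu0.le
    nlinarith [mul_pos hu0 hu0, mul_pos hu0 (by linarith : 0 < l)]
  refine le_trans ?_ hbound
  -- At k = 0 the potential says nothing about f(y) since A₀ = 0; there the gradient is compared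
  -- with the zero gradient at x^*.
  rcases Nat.eq_zero_or_pos k with rfl | hk
  · have hxD : ‖x - xstar‖ ≤ D := norm_convex_comb_sub_le hA hα hy hz
    have h1 := hs.gradient_lipschitz x xstar
    rw [hgrad0, sub_zero] at h1
    have h2 : alpha a L (0 + 1) * ‖gradient f x‖ ≤ alpha a L (0 + 1) * (L * D) :=
      mul_le_mul_of_nonneg_left (h1.trans (mul_le_mul_of_nonneg_left hxD hL.le)) hα.le
    have h3 : alpha a L (0 + 1) * (L * D) = D * (1 / u ^ 2) := by
      rw [alpha, hu2]; field_simp; norm_num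
    rw [h3] at h2
    refine h2.trans (mul_le_mul_of_nonneg_left ?_ hD)
    have : 0 ≤ 3 / (2 * u) := by positivity
    have h4 : 0 ≤ 1 / u ^ 2 := by positivity
    linarith [show 2 / u ^ 2 = 1 / u ^ 2 + 1 / u ^ 2 by ring]
  · have hk1 : (1 : ℝ) ≤ k := by exact_mod_cast hk
    have hxy : x - y = (alpha a L (k + 1) / bigA a L (k + 1)) • (z - y) := by
      have e : bigA a L (k + 1) = bigA a L k + alpha a L (k + 1) := rfl
      have hne : bigA a L k + alpha a L (k + 1) ≠ 0 := by rw [← e]; exact hA'.ne'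
      rw [hx, queryPoint, e]
      have : y = (1 / (bigA a L k + alpha a L (k + 1))) •
          ((bigA a L k + alpha a L (k + 1)) • y) := by
        rw [smul_smul, one_div_mul_cancel hne, one_smul]
      nth_rewrite 2 [this]
      module
    have hzy : ‖z - y‖ ≤ 2 * D := by
      have : z - y = (z - xstar) - (y - xstar) := by abel
      rw [this]
      linarith [norm_sub_le (z - xstar) (y - xstar)]
    have h1 : alpha a L (k + 1) * ‖gradient f x - gradient f y‖ ≤ D * (2 / u ^ 2) := by
      have h2 := hs.gradient_lipschitz x y
      rw [hxy, norm_smul, Real.norm_of_nonneg (by positivity)] at h2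
      have h3 : L * alpha a L (k + 1) ^ 2 / bigA a L (k + 1) ≤ 1 / a := by
        rw [div_le_div_iff₀ hA' ha0]; linarith
      calc _ ≤ alpha a L (k + 1) * (L * (alpha a L (k + 1) / bigA a L (k + 1) * ‖z - y‖)) :=
            mul_le_mul_of_nonneg_left h2 hα.le
        _ = L * alpha a L (k + 1) ^ 2 / bigA a L (k + 1) * ‖z - y‖ := by ring
        _ ≤ 1 / a * (2 * D) := mul_le_mul h3 hzy (norm_nonneg _) (by positivity)
        _ = _ := by rw [hu2]; ring
    have h2 : alpha a L (k + 1) * ‖gradient f y‖ ≤ D * (3 / (2 * u)) := by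
      refine le_of_sq_le_sq ?_ (by positivity)
      have h3 := sq_norm_gradient_le hL hs.differentiable hs.gradient_lipschitz hmin y
      have hAk : 0 < bigA a L k := by rw [bigA_eq]; positivity
      -- This amounts to 4(k+2)² ≤ 9k(k+3), with equality at k = 1.
      have h4 : alpha a L (k + 1) ^ 2 * (4 * a) * L ≤ 9 * bigA a L k := by
        rw [bigA_eq, alpha]
        have : ((k + 2 : ℝ) / (2 * a * L)) ^ 2 * (4 * a) * L = (k + 2) ^ 2 * 4 / (4 * a * L) := by
          field_simp
          norm_num
        rw [this, ← mul_div_assoc]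
        refine div_le_div_of_nonneg_right ?_ (by positivity)
        nlinarith
      have h5 : f y - f xstar ≤ D ^ 2 / 2 / bigA a L k := by
        rw [le_div_iff₀ hAk]; linarith
      calc (alpha a L (k + 1) * ‖gradient f y‖) ^ 2
          = alpha a L (k + 1) ^ 2 * ‖gradient f y‖ ^ 2 := by ring
        _ ≤ alpha a L (k + 1) ^ 2 * (2 * L * (D ^ 2 / 2 / bigA a L k)) := by
            refine mul_le_mul_of_nonneg_left (h3.trans ?_) (by positivity)
            exact mul_le_mul_of_nonneg_left h5 (by positivity)
        _ = alpha a L (k + 1) ^ 2 * (4 * a) * L * (D ^ 2 / (4 * a * bigA a L k)) := by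
            field_simp
        _ ≤ 9 * bigA a L k * (D ^ 2 / (4 * a * bigA a L k)) :=
            mul_le_mul_of_nonneg_right h4 (by positivity)
        _ = (D * (3 / (2 * u))) ^ 2 := by
            rw [mul_pow, div_pow, mul_pow, hu2]; field_simp; ring
    have h3 : ‖gradient f x‖ ≤ ‖gradient f x - gradient f y‖ + ‖gradient f y‖ := by
      simpa using norm_add_le (gradient f x - gradient f y) (gradient f y)
    calc _ ≤ alpha a L (k + 1) * (‖gradient f x - gradient f y‖ + ‖gradient f y‖) :=
          mul_le_mul_of_nonneg_left h3 hα.le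
      _ ≤ _ := by rw [mul_add, mul_add]; exact add_le_add h1 h2

end Deterministic

end

/-! ### Moments of the clipped mini-batch gradient -/

section Moments

variable {Ω : Type*} [MeasurableSpace Ω] {μ : Measure Ω}
  {E : Type*} [NormedAddCommGroup E] [InnerProductSpace ℝ E] [CompleteSpace E]

/-- The second moment of a sum of pairwise independent centered random vectors. -/
lemma integral_norm_sq_sum_of_indepFun [MeasurableSpace E] [BorelSpace E]
    [IsProbabilityMeasure μ] {ι : Type*} (t : Finset ι)
    {Y : ι → Ω → E}
    (hY : ∀ i, MemLp (Y i) 2 μ) (h0 : ∀ i, ∫ ω, Y i ω ∂μ = 0)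
    (hind : Pairwise fun i j => IndepFun (Y i) (Y j) μ) :
    ∫ ω, ‖∑ i ∈ t, Y i ω‖ ^ 2 ∂μ = ∑ i ∈ t, ∫ ω, ‖Y i ω‖ ^ 2 ∂μ := by
  classical
  have hint : ∀ i j, Integrable (fun ω => inner ℝ (Y i ω) (Y j ω)) μ := fun i j => by
    refine Integrable.mono' (((hY i).integrable_norm_pow two_ne_zero).add
      ((hY j).integrable_norm_pow two_ne_zero)) ((hY i).1.inner (hY j).1) (.of_forall fun ω => ?_)
    have := abs_real_inner_le_norm (Y i ω) (Y j ω)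
    simp only [Pi.add_apply, Real.norm_eq_abs]
    nlinarith [sq_nonneg (‖Y i ω‖ - ‖Y j ω‖), sq_nonneg ‖Y i ω‖, sq_nonneg ‖Y j ω‖]
  have hval : ∀ i j, ∫ ω, inner ℝ (Y i ω) (Y j ω) ∂μ =
      if i = j then ∫ ω, ‖Y i ω‖ ^ 2 ∂μ else 0 := by
    intro i j
    split_ifs with h
    · subst h
      simp only [real_inner_self_eq_norm_sq]
    · have := (hind h).integral_bilin ((hY i).integrable one_le_two)
        ((hY j).integrable one_le_two) (innerSL ℝ)
      rw [h0, map_zero, zero_apply] at this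
      exact this
  simp only [← real_inner_self_eq_norm_sq, sum_inner, inner_sum]
  rw [integral_finsetSum _ fun i _ => integrable_finsetSum _ fun j _ => hint j i]
  refine Finset.sum_congr rfl fun i hi => ?_
  rw [integral_finsetSum _ fun j _ => hint j i]
  simp only [hval, real_inner_self_eq_norm_sq]
  rw [Finset.sum_ite_eq', if_pos hi]

/-- Bernstein's argument: e^u ≤ 1 + u + u² for |u| ≤ 1, which `hsb` ensures. The linear term is
bounded through the mean and second moment of V, and the square through |⟨V, v⟩ + ‖V‖²| ≤ ‖V‖(b +
c); then 1 + t ≤ e^t. -/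
lemma integral_exp_le [IsProbabilityMeasure μ] {V : Ω → E} (hV : AEStronglyMeasurable V μ) {v : E}
    {b c e p s : ℝ} (hs : 0 ≤ s) (hb : ∀ ω, ‖V ω‖ ≤ b) (hc : ‖v‖ ≤ c)
    (hp : ∫ ω, ‖V ω‖ ^ 2 ∂μ ≤ p) (he : ‖∫ ω, V ω ∂μ‖ ≤ e) (hsb : s * (b * (b + c)) ≤ 1) :
    ∫⁻ ω, ENNReal.ofReal (Real.exp (s * (inner ℝ (V ω) v + ‖V ω‖ ^ 2))) ∂μ ≤
      ENNReal.ofReal (Real.exp (s * (e * c + p) + s ^ 2 * (b + c) ^ 2 * p)) := by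
  have hc0 : 0 ≤ c := (norm_nonneg _).trans hc
  have hVi : Integrable V μ := Integrable.of_bound hV b (.of_forall hb)
  have hV2 : Integrable (fun ω => ‖V ω‖ ^ 2) μ := by
    refine Integrable.of_bound (hV.norm.pow 2) (b ^ 2) (.of_forall fun ω => ?_)
    rw [Real.norm_of_nonneg (by positivity)]
    exact pow_le_pow_left₀ (norm_nonneg _) (hb ω) 2
  have hVv : Integrable (fun ω => inner ℝ (V ω) v) μ := hVi.inner_const v
  have habs : ∀ ω, |inner ℝ (V ω) v + ‖V ω‖ ^ 2| ≤ ‖V ω‖ * (b + c) := fun ω => by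
    have h1 := abs_real_inner_le_norm (V ω) v
    have h2 := abs_add_le (inner ℝ (V ω) v) (‖V ω‖ ^ 2)
    rw [abs_of_nonneg (sq_nonneg ‖V ω‖)] at h2
    nlinarith [norm_nonneg (V ω), hb ω]
  have hexp : ∀ ω, Real.exp (s * (inner ℝ (V ω) v + ‖V ω‖ ^ 2)) ≤
      1 + s * (inner ℝ (V ω) v + ‖V ω‖ ^ 2) + s ^ 2 * (b + c) ^ 2 * ‖V ω‖ ^ 2 := fun ω => by
    have hb0 : 0 ≤ b := (norm_nonneg _).trans (hb ω)
    have h1 : |s * (inner ℝ (V ω) v + ‖V ω‖ ^ 2)| ≤ 1 := by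
      rw [abs_mul, abs_of_nonneg hs]
      refine le_trans (mul_le_mul_of_nonneg_left ((habs ω).trans ?_) hs) hsb
      exact mul_le_mul_of_nonneg_right (hb ω) (by linarith)
    have h2 := (abs_le.1 (Real.abs_exp_sub_one_sub_id_le h1)).2
    have h3 : (inner ℝ (V ω) v + ‖V ω‖ ^ 2) ^ 2 ≤ (‖V ω‖ * (b + c)) ^ 2 := sq_le_sq'
      (abs_le.1 (habs ω)).1 (abs_le.1 (habs ω)).2
    nlinarith [mul_le_mul_of_nonneg_left h3 (sq_nonneg s)]
  have hq : Integrable (fun ω => 1 + s * (inner ℝ (V ω) v + ‖V ω‖ ^ 2) +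
      s ^ 2 * (b + c) ^ 2 * ‖V ω‖ ^ 2) μ :=
    ((integrable_const _).add ((hVv.add hV2).const_mul s)).add (hV2.const_mul _)
  calc _ ≤ ∫⁻ ω, ENNReal.ofReal (1 + s * (inner ℝ (V ω) v + ‖V ω‖ ^ 2) +
      s ^ 2 * (b + c) ^ 2 * ‖V ω‖ ^ 2) ∂μ :=
        lintegral_mono fun ω => ENNReal.ofReal_le_ofReal (hexp ω)
    _ = ENNReal.ofReal (∫ ω, (1 + s * (inner ℝ (V ω) v + ‖V ω‖ ^ 2) +
      s ^ 2 * (b + c) ^ 2 * ‖V ω‖ ^ 2) ∂μ) :=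
        (ofReal_integral_eq_lintegral_ofReal hq
          (.of_forall fun ω => (Real.exp_pos _).le.trans (hexp ω))).symm
    _ ≤ _ := by
      refine ENNReal.ofReal_le_ofReal ?_
      have h1 : ∫ ω, (1 + s * (inner ℝ (V ω) v + ‖V ω‖ ^ 2) +
          s ^ 2 * (b + c) ^ 2 * ‖V ω‖ ^ 2) ∂μ = 1 + s * (inner ℝ (∫ ω, V ω ∂μ) v +
            ∫ ω, ‖V ω‖ ^ 2 ∂μ) + s ^ 2 * (b + c) ^ 2 * ∫ ω, ‖V ω‖ ^ 2 ∂μ := by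
        have h2 : Integrable (fun ω => s * (inner ℝ (V ω) v + ‖V ω‖ ^ 2)) μ :=
          (hVv.add hV2).const_mul s
        have h3 : Integrable (fun ω => 1 + s * (inner ℝ (V ω) v + ‖V ω‖ ^ 2)) μ :=
          (integrable_const _).add h2
        rw [integral_add h3 (hV2.const_mul _), integral_add (integrable_const _) h2,
          integral_const_mul, integral_const_mul, integral_add hVv hV2]
        have : ∫ ω, inner ℝ (V ω) v ∂μ = inner ℝ (∫ ω, V ω ∂μ) v := by
          have := integral_inner (𝕜 := ℝ) hVi v
          simpa only [real_inner_comm] using this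
        rw [this]
        simp
      rw [h1]
      have h2 : inner ℝ (∫ ω, V ω ∂μ) v ≤ e * c :=
        (real_inner_le_norm _ _).trans (mul_le_mul he hc (norm_nonneg _)
          ((norm_nonneg _).trans he))
      have h3 := Real.add_one_le_exp (s * (e * c + p) + s ^ 2 * (b + c) ^ 2 * p)
      have h4 := mul_le_mul_of_nonneg_left (add_le_add h2 hp) hs
      have h5 := mul_le_mul_of_nonneg_left hp (show 0 ≤ s ^ 2 * (b + c) ^ 2 by positivity)
      linarith

end Moments

/-! ### Mini-batches, the clipped gradient error and its exponential moment -/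

section Sampling

variable {n : ℕ} {Ω Ξ : Type*} [MeasurableSpace Ω] [MeasurableSpace Ξ] {μ : Measure Ω}
  {P : Measure Ξ} {f : EuclideanSpace ℝ (Fin n) → ℝ}
  {g : EuclideanSpace ℝ (Fin n) → Ξ → EuclideanSpace ℝ (Fin n)} {ξ : ℕ → ℕ → Ω → Ξ} {σ : ℝ}

lemma measurable_clip (l : ℝ) : Measurable fun v : EuclideanSpace ℝ (Fin n) => clip v l := by
  unfold clip
  fun_prop

lemma IsStochasticGradient.measurable_apply (hg : IsStochasticGradient f P g σ)
    (x : EuclideanSpace ℝ (Fin n)) : Measurable (g x) :=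
  hg.measurable.comp measurable_prodMk_left

lemma IsIIDSample.integrable_comp (hξ : IsIIDSample μ P ξ) {F : Type*} [NormedAddCommGroup F]
    {h : Ξ → F} (hh : Integrable h P) (k i : ℕ) :
    Integrable (fun ω => h (ξ k i ω)) μ := by
  rw [← hξ.law k i] at hh
  exact hh.comp_measurable (hξ.measurable k i)

lemma IsIIDSample.integral_comp (hξ : IsIIDSample μ P ξ) {F : Type*} [NormedAddCommGroup F]
    [NormedSpace ℝ F] {h : Ξ → F} (hh : Integrable h P) (k i : ℕ) :
    ∫ ω, h (ξ k i ω) ∂μ = ∫ t, h t ∂P := by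
  rw [← hξ.law k i] at hh ⊢
  rw [integral_map (hξ.measurable k i).aemeasurable hh.aestronglyMeasurable]

variable [IsProbabilityMeasure μ] [IsProbabilityMeasure P]

/-- Cross terms of the centered samples vanish by pairwise independence, which gives the factor 1/m.
-/
lemma miniBatch_moments (hg : IsStochasticGradient f P g σ) (hξ : IsIIDSample μ P ξ) (k : ℕ)
    {m : ℕ} (hm : 0 < m) (x : EuclideanSpace ℝ (Fin n)) :
    Integrable (fun ω => miniBatch g m (fun i => ξ k i ω) x) μ ∧
    ∫ ω, miniBatch g m (fun i => ξ k i ω) x ∂μ = gradient f x ∧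
    Integrable (fun ω => ‖miniBatch g m (fun i => ξ k i ω) x - gradient f x‖ ^ 2) μ ∧
    ∫ ω, ‖miniBatch g m (fun i => ξ k i ω) x - gradient f x‖ ^ 2 ∂μ ≤ σ ^ 2 / m := by
  have hm' : (m : ℝ) ≠ 0 := by positivity
  have hsum : Integrable (fun ω => ∑ i ∈ Finset.range m, g x (ξ k i ω)) μ :=
    integrable_finsetSum _ fun i _ => hξ.integrable_comp (hg.integrable x) k i
  set d := gradient f x with hd
  let h : Ξ → EuclideanSpace ℝ (Fin n) := fun t => g x t - d
  have hmeas : Measurable h := (hg.measurable_apply x).sub_const d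
  have hh1 : Integrable h P := (hg.integrable x).sub (integrable_const d)
  have hY : ∀ i, MemLp (fun ω => h (ξ k i ω)) 2 μ := fun i =>
    (memLp_two_iff_integrable_sq_norm
      (hmeas.comp (hξ.measurable k i)).aestronglyMeasurable).2
      (hξ.integrable_comp (hg.integrable_sq x) k i)
  have h0 : ∀ i, ∫ ω, h (ξ k i ω) ∂μ = 0 := fun i => by
    rw [hξ.integral_comp hh1, integral_sub (hg.integrable x) (integrable_const d), hg.unbiased x]
    simp [hd]
  have hind : Pairwise fun i j => IndepFun (fun ω => h (ξ k i ω)) (fun ω => h (ξ k j ω)) μ :=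
    fun i j hij => (hξ.indep.indepFun (i := (k, i)) (j := (k, j)) (by simpa using hij)).comp
      hmeas hmeas
  have hdiff : ∀ ω, miniBatch g m (fun i => ξ k i ω) x - d =
      (1 / (m : ℝ)) • ∑ i ∈ Finset.range m, h (ξ k i ω) := fun ω => by
    rw [miniBatch, Finset.sum_sub_distrib, Finset.sum_const, Finset.card_range, smul_sub,
      ← Nat.cast_smul_eq_nsmul ℝ, smul_smul, one_div_mul_cancel hm', one_smul]
  have hsq : ∀ ω, ‖miniBatch g m (fun i => ξ k i ω) x - d‖ ^ 2 =
      (1 / (m : ℝ)) ^ 2 * ‖∑ i ∈ Finset.range m, h (ξ k i ω)‖ ^ 2 := fun ω => by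
    rw [hdiff, norm_smul, mul_pow, Real.norm_eq_abs, sq_abs]
  refine ⟨hsum.smul (1 / (m : ℝ)), ?_, ?_, ?_⟩
  · simp only [miniBatch]
    rw [integral_smul, integral_finsetSum _ fun i _ => hξ.integrable_comp (hg.integrable x) k i]
    simp only [hξ.integral_comp (hg.integrable x), hg.unbiased x, Finset.sum_const,
      Finset.card_range]
    rw [← Nat.cast_smul_eq_nsmul ℝ, smul_smul, one_div_mul_cancel hm', one_smul]
  · simp only [hsq]
    refine Integrable.const_mul ?_ _
    exact (memLp_two_iff_integrable_sq_norm (memLp_finsetSum _ fun i _ => hY i).1).1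
      (memLp_finsetSum _ fun i _ => hY i)
  · simp only [hsq]
    rw [integral_const_mul, integral_norm_sq_sum_of_indepFun _ hY h0 hind]
    have h1 : ∀ i, ∫ ω, ‖h (ξ k i ω)‖ ^ 2 ∂μ ≤ σ ^ 2 := fun i => by
      rw [hξ.integral_comp (h := fun t => ‖h t‖ ^ 2) (hg.integrable_sq x)]
      exact hg.variance_le x
    calc _ ≤ (1 / (m : ℝ)) ^ 2 * ∑ i ∈ Finset.range m, σ ^ 2 :=
          mul_le_mul_of_nonneg_left (Finset.sum_le_sum fun i _ => h1 i) (by positivity)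
      _ = _ := by
        rw [Finset.sum_const, Finset.card_range, nsmul_eq_mul]
        field_simp

/-- The bounds on the scaled error of the clipped gradient: uniform, in mean square, and for the
mean. -/
lemma scaledError_moments (hg : IsStochasticGradient f P g σ) (hξ : IsIIDSample μ P ξ)
    {a L B : ℝ} {k m : ℕ} (hm : 0 < m) (hα : 0 < alpha a L (k + 1)) (hB : 0 < B)
    {x : EuclideanSpace ℝ (Fin n)} (hx : alpha a L (k + 1) * ‖gradient f x‖ ≤ B / 2) :
    AEStronglyMeasurable (fun ω => scaledError f g a L B k m x (fun i => ξ k i ω)) μ ∧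
    (∀ ω, ‖scaledError f g a L B k m x (fun i => ξ k i ω)‖ ≤ 3 * B / 2) ∧
    ∫ ω, ‖scaledError f g a L B k m x (fun i => ξ k i ω)‖ ^ 2 ∂μ ≤
      alpha a L (k + 1) ^ 2 * (σ ^ 2 / m) ∧
    ‖∫ ω, scaledError f g a L B k m x (fun i => ξ k i ω) ∂μ‖ ≤
      alpha a L (k + 1) ^ 2 * (σ ^ 2 / m) / (2 * B) := by
  obtain ⟨hG, hGmean, hG2, hGvar⟩ := miniBatch_moments hg hξ k hm x
  set α := alpha a L (k + 1) with hαdef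
  set d := gradient f x with hd
  set G : Ω → EuclideanSpace ℝ (Fin n) := fun ω => miniBatch g m (fun i => ξ k i ω) x with hGdef
  have hl : 0 < B / α := div_pos hB hα
  have hdl : ‖d‖ ≤ B / α / 2 := by
    rw [div_right_comm, le_div_iff₀ hα]; linarith
  have hclip : AEStronglyMeasurable (fun ω => clip (G ω) (B / α)) μ :=
    ((measurable_clip _).comp_aemeasurable hG.aemeasurable).aestronglyMeasurable
  have hclipi : Integrable (fun ω => clip (G ω) (B / α)) μ :=
    Integrable.of_bound hclip (B / α) (.of_forall fun ω => norm_clip_le _ hl.le)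
  have hn : ∀ ω, ‖scaledError f g a L B k m x (fun i => ξ k i ω)‖ = α * ‖clip (G ω) (B / α) - d‖ :=
    fun ω => by rw [scaledError, norm_smul, Real.norm_of_nonneg hα.le]
  refine ⟨(hclip.sub aestronglyMeasurable_const).const_smul α, fun ω => ?_, ?_, ?_⟩
  · rw [hn]
    have h1 := norm_sub_le (clip (G ω) (B / α)) d
    have h2 := norm_clip_le (G ω) hl.le
    calc _ ≤ α * (B / α + B / α / 2) := mul_le_mul_of_nonneg_left (by linarith) hα.le
      _ = _ := by field_simp; ring
  · simp only [hn, mul_pow]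
    rw [integral_const_mul]
    refine mul_le_mul_of_nonneg_left (le_trans ?_ hGvar) (by positivity)
    refine integral_mono_of_nonneg (.of_forall fun ω => by positivity) hG2 (.of_forall fun ω => ?_)
    exact pow_le_pow_left₀ (norm_nonneg _) (norm_clip_sub_le (by linarith)) 2
  · have h1 : ∫ ω, scaledError f g a L B k m x (fun i => ξ k i ω) ∂μ =
        α • ∫ ω, (clip (G ω) (B / α) - G ω) ∂μ := by
      simp only [scaledError]
      rw [integral_smul, integral_sub hclipi (integrable_const _), integral_sub hclipi hG, hGmean]
      simp [hαdef, hd]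
    rw [h1, norm_smul, Real.norm_of_nonneg hα.le]
    have h2 : ‖∫ ω, (clip (G ω) (B / α) - G ω) ∂μ‖ ≤
        ∫ ω, ‖G ω - d‖ ^ 2 / (2 * (B / α)) ∂μ :=
      norm_integral_le_of_norm_le (hG2.div_const _)
        (.of_forall fun ω => norm_clip_sub_self_le hl hdl)
    rw [integral_div] at h2
    calc _ ≤ α * (σ ^ 2 / m / (2 * (B / α))) := by
          refine mul_le_mul_of_nonneg_left (h2.trans ?_) hα.le
          exact div_le_div_of_nonneg_right hGvar (by positivity)
      _ = _ := by field_simp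

/-- The conditional exponential moment of a noise term. -/
lemma lintegral_exp_noiseTerm_le (hg : IsStochasticGradient f P g σ) (hξ : IsIIDSample μ P ξ)
    {a L D l N : ℝ} {k m : ℕ} (hm : 0 < m) (hα : 0 < alpha a L (k + 1)) (hD : 0 < D)
    (hl : 2 ≤ l) (hN : 0 < N) {xstar y z : EuclideanSpace ℝ (Fin n)} (hz : ‖z - xstar‖ ≤ D)
    (hx : alpha a L (k + 1) * ‖gradient f (queryPoint a L k y z)‖ ≤ D / (16 * l))
    (hvar : alpha a L (k + 1) ^ 2 * (σ ^ 2 / m) ≤ D ^ 2 / (6000 * N * l)) :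
    ∫⁻ ω, ENNReal.ofReal (Real.exp (4 * l / D ^ 2 *
        noiseTerm f g xstar a L (D / (8 * l)) k m y z (fun i => ξ k i ω))) ∂μ ≤
      ENNReal.ofReal (Real.exp (l / (100 * N))) := by
  have hl0 : 0 < l := by linarith
  have hB : 0 < D / (8 * l) := by positivity
  obtain ⟨h1, h2, h3, h4⟩ := scaledError_moments hg hξ (k := k) hm hα hB
    (x := queryPoint a L k y z) (hx.trans_eq (by field_simp; norm_num))
  set p := alpha a L (k + 1) ^ 2 * (σ ^ 2 / m) with hp
  have hp0 : 0 ≤ p := by positivity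
  have hv : ‖xstar - z + alpha a L (k + 1) • gradient f (queryPoint a L k y z)‖ ≤ 33 / 32 * D := by
    have e1 := norm_add_le (xstar - z) (alpha a L (k + 1) • gradient f (queryPoint a L k y z))
    rw [norm_smul, Real.norm_of_nonneg hα.le, norm_sub_rev] at e1
    have e2 : D / (16 * l) ≤ D / 32 := div_le_div_of_nonneg_left hD.le (by norm_num) (by linarith)
    linarith
  have hb : 3 * (D / (8 * l)) / 2 = 3 * D / (16 * l) := by field_simp; norm_num
  have hb2 : 3 * D / (16 * l) + 33 / 32 * D ≤ 9 / 8 * D := by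
    have : 3 * D / (16 * l) ≤ 3 * D / 32 :=
      div_le_div_of_nonneg_left (by positivity) (by norm_num) (by linarith)
    linarith
  rw [hb] at h2
  have hb0 : 0 ≤ 3 * D / (16 * l) + 33 / 32 * D := by positivity
  have hs : 4 * l / D ^ 2 * (3 * D / (16 * l) * (3 * D / (16 * l) + 33 / 32 * D)) ≤ 1 := by
    calc _ ≤ 4 * l / D ^ 2 * (3 * D / (16 * l) * (9 / 8 * D)) := by gcongr
      _ = 27 / 32 := by field_simp; norm_num
      _ ≤ 1 := by norm_num
  refine (integral_exp_le h1 (by positivity) h2 hv h3 h4 hs).trans ?_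
  refine ENNReal.ofReal_le_ofReal (Real.exp_le_exp.2 ?_)
  -- The factor is at most 60l²/D² because l ≥ 2, and 6000 = 60 · 100 in the batch size leaves
  -- l/(100N).
  calc _ ≤ 4 * l / D ^ 2 * (p / (2 * (D / (8 * l))) * (33 / 32 * D) + p) +
        (4 * l / D ^ 2) ^ 2 * (9 / 8 * D) ^ 2 * p := by gcongr
    _ = (4 * l / D ^ 2 * (33 / 8 * l + 1) + 81 / 4 * l ^ 2 / D ^ 2) * p := by
      field_simp; ring
    _ ≤ (60 * l ^ 2 / D ^ 2) * p := by
      refine mul_le_mul_of_nonneg_right ?_ hp0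
      rw [div_mul_eq_mul_div, ← add_div]
      refine div_le_div_of_nonneg_right ?_ (by positivity)
      nlinarith
    _ ≤ (60 * l ^ 2 / D ^ 2) * (D ^ 2 / (6000 * N * l)) :=
      mul_le_mul_of_nonneg_left hvar (by positivity)
    _ = _ := by field_simp; norm_num

end Sampling

/-! ### The exponential supermartingale -/

noncomputable section

variable {n : ℕ} {Ω Ξ : Type*} {f : EuclideanSpace ℝ (Fin n) → ℝ}
  {g : EuclideanSpace ℝ (Fin n) → Ξ → EuclideanSpace ℝ (Fin n)} {ξ : ℕ → ℕ → Ω → Ξ}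
  {σ a L B T D R0 l N : ℝ} {m : ℕ → ℕ} {xstar x0 : EuclideanSpace ℝ (Fin n)}

/-- The update of `(y^k, z^k)` and of the stopped noise, as one map. -/
def trackedStep (f : EuclideanSpace ℝ (Fin n) → ℝ)
    (g : EuclideanSpace ℝ (Fin n) → Ξ → EuclideanSpace ℝ (Fin n))
    (xstar : EuclideanSpace ℝ (Fin n)) (a L B T : ℝ) (k m : ℕ)
    (p : ((EuclideanSpace ℝ (Fin n) × EuclideanSpace ℝ (Fin n)) × ℝ) × (ℕ → Ξ)) :
    (EuclideanSpace ℝ (Fin n) × EuclideanSpace ℝ (Fin n)) × ℝ :=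
  (((step g a L B k m p.2 ⟨p.1.1.1, p.1.1.2⟩).y, (step g a L B k m p.2 ⟨p.1.1.1, p.1.1.2⟩).z),
    p.1.2 + if p.1.2 ≤ T then noiseTerm f g xstar a L B k m p.1.1.1 p.1.1.2 p.2 else 0)

/-- The pair `(y^k, z^k)` together with the stopped noise. -/
def tracked (f : EuclideanSpace ℝ (Fin n) → ℝ)
    (g : EuclideanSpace ℝ (Fin n) → Ξ → EuclideanSpace ℝ (Fin n))
    (xstar x0 : EuclideanSpace ℝ (Fin n)) (a L B T : ℝ) (m : ℕ → ℕ) (ξ : ℕ → ℕ → Ω → Ξ)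
    (k : ℕ) (ω : Ω) : (EuclideanSpace ℝ (Fin n) × EuclideanSpace ℝ (Fin n)) × ℝ :=
  (((run g x0 a L B m (fun k i => ξ k i ω) k).y, (run g x0 a L B m (fun k i => ξ k i ω) k).z),
    stoppedNoise f g xstar x0 a L B T m (fun k i => ξ k i ω) k)

lemma tracked_succ (k : ℕ) : tracked f g xstar x0 a L B T m ξ (k + 1) = fun ω =>
    trackedStep f g xstar a L B T k (m k)
      (tracked f g xstar x0 a L B T m ξ k ω, fun i => ξ k i ω) := rfl

lemma IsLSmooth.measurable_gradient (hs : IsLSmooth f L) (hL : 0 ≤ L) :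
    Measurable (gradient f) := by
  refine (LipschitzWith.of_dist_le_mul (K := ⟨L, hL⟩) fun x y => ?_).continuous.measurable
  rw [dist_eq_norm, dist_eq_norm]
  exact hs.gradient_lipschitz x y

variable [MeasurableSpace Ξ]

lemma measurable_miniBatch (hg : Measurable (Function.uncurry g)) (m : ℕ) :
    Measurable fun p : EuclideanSpace ℝ (Fin n) × (ℕ → Ξ) => miniBatch g m p.2 p.1 := by
  have h : Measurable fun p : EuclideanSpace ℝ (Fin n) × (ℕ → Ξ) =>
      ∑ i ∈ Finset.range m, g p.1 (p.2 i) :=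
    Finset.measurable_fun_sum _ fun i _ =>
      hg.comp (measurable_fst.prodMk ((measurable_pi_apply i).comp measurable_snd))
  exact h.const_smul (1 / (m : ℝ))

lemma measurable_queryPoint (a L : ℝ) (k : ℕ) :
    Measurable fun p : EuclideanSpace ℝ (Fin n) × EuclideanSpace ℝ (Fin n) =>
      queryPoint a L k p.1 p.2 := by
  unfold queryPoint
  fun_prop

lemma measurable_noiseTerm (hs : IsLSmooth f L) (hL : 0 ≤ L)
    (hg : Measurable (Function.uncurry g)) (xstar : EuclideanSpace ℝ (Fin n)) (a B : ℝ)
    (k m : ℕ) :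
    Measurable fun p : (EuclideanSpace ℝ (Fin n) × EuclideanSpace ℝ (Fin n)) × (ℕ → Ξ) =>
      noiseTerm f g xstar a L B k m p.1.1 p.1.2 p.2 := by
  have hx : Measurable fun p : (EuclideanSpace ℝ (Fin n) × EuclideanSpace ℝ (Fin n)) × (ℕ → Ξ) =>
      queryPoint a L k p.1.1 p.1.2 := (measurable_queryPoint a L k).comp measurable_fst
  have hd := (hs.measurable_gradient hL).comp hx
  have he : Measurable fun p : (EuclideanSpace ℝ (Fin n) × EuclideanSpace ℝ (Fin n)) × (ℕ → Ξ) =>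
      scaledError f g a L B k m (queryPoint a L k p.1.1 p.1.2) p.2 :=
    (((measurable_clip (B / alpha a L (k + 1))).comp ((measurable_miniBatch hg m).comp
      (hx.prodMk measurable_snd))).sub hd).const_smul (alpha a L (k + 1))
  have hw : Measurable fun p : (EuclideanSpace ℝ (Fin n) × EuclideanSpace ℝ (Fin n)) × (ℕ → Ξ) =>
      xstar - p.1.2 + alpha a L (k + 1) • gradient f (queryPoint a L k p.1.1 p.1.2) :=
    (measurable_fst.snd.const_sub xstar).add (hd.const_smul (alpha a L (k + 1)))
  have hi := he.inner (𝕜 := ℝ) hw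
  exact hi.add (he.norm.pow_const 2)

lemma measurable_trackedStep (hs : IsLSmooth f L) (hL : 0 ≤ L)
    (hg : Measurable (Function.uncurry g)) (xstar : EuclideanSpace ℝ (Fin n)) (a B T : ℝ)
    (k m : ℕ) : Measurable (trackedStep f g xstar a L B T k m) := by
  have hyz : Measurable fun p : ((EuclideanSpace ℝ (Fin n) × EuclideanSpace ℝ (Fin n)) × ℝ) ×
      (ℕ → Ξ) => p.1.1 := measurable_fst.fst
  have hx := (measurable_queryPoint a L k).comp hyz
  have hz : Measurable fun p : ((EuclideanSpace ℝ (Fin n) × EuclideanSpace ℝ (Fin n)) × ℝ) ×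
      (ℕ → Ξ) => (step g a L B k m p.2 ⟨p.1.1.1, p.1.1.2⟩).z :=
    hyz.snd.sub (((measurable_clip (B / alpha a L (k + 1))).comp ((measurable_miniBatch hg m).comp
      (hx.prodMk measurable_snd))).const_smul (alpha a L (k + 1)))
  have hy : Measurable fun p : ((EuclideanSpace ℝ (Fin n) × EuclideanSpace ℝ (Fin n)) × ℝ) ×
      (ℕ → Ξ) => (step g a L B k m p.2 ⟨p.1.1.1, p.1.1.2⟩).y :=
    ((hyz.fst.const_smul (bigA a L k)).add (hz.const_smul (alpha a L (k + 1)))).const_smul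
      (1 / bigA a L (k + 1))
  refine (hy.prodMk hz).prodMk (measurable_fst.snd.add (Measurable.ite ?_ ?_ measurable_const))
  · exact measurableSet_le measurable_fst.snd measurable_const
  · have := (measurable_noiseTerm hs hL hg xstar a B k m).comp (hyz.prodMk measurable_snd)
    simpa only [Function.comp_def] using this

/-- The `σ`-algebra generated by the samples of the iterations in `S`. -/
@[reducible] def sampleSigma (ξ : ℕ → ℕ → Ω → Ξ) (S : Set ℕ) : MeasurableSpace Ω :=
  ⨆ p ∈ {p : ℕ × ℕ | p.1 ∈ S}, MeasurableSpace.comap (ξ p.1 p.2) inferInstance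

lemma sampleSigma_mono {S S' : Set ℕ} (h : S ⊆ S') : sampleSigma ξ S ≤ sampleSigma ξ S' :=
  biSup_mono fun _ hp => h hp

lemma measurable_samples {S : Set ℕ} {k : ℕ} (hk : k ∈ S) :
    Measurable[sampleSigma ξ S] fun ω i => ξ k i ω := by
  refine @measurable_pi_lambda Ω ℕ (fun _ => Ξ) (sampleSigma ξ S) _ _ fun i => ?_
  refine Measurable.of_comap_le ?_
  exact le_iSup₂_of_le (f := fun p (_ : p ∈ {p : ℕ × ℕ | p.1 ∈ S}) =>
    MeasurableSpace.comap (ξ p.1 p.2) inferInstance) (k, i) hk le_rfl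

/-- Adaptedness: `Set.Iio k` is strict because iteration k draws its samples after the k-th state is
formed. -/
lemma measurable_tracked (hs : IsLSmooth f L) (hL : 0 ≤ L)
    (hg : Measurable (Function.uncurry g)) (k : ℕ) :
    Measurable[sampleSigma ξ (Set.Iio k)] (tracked f g xstar x0 a L B T m ξ k) := by
  induction k with
  | zero => exact measurable_const (a := ((x0, x0), (0 : ℝ)))
  | succ k ih =>
    have h1 : Measurable[sampleSigma ξ (Set.Iio (k + 1))] (tracked f g xstar x0 a L B T m ξ k) :=
      ih.mono (sampleSigma_mono (Set.Iio_subset_Iio k.le_succ)) le_rfl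
    have h2 : Measurable[sampleSigma ξ (Set.Iio (k + 1))] fun ω i => ξ k i ω :=
      measurable_samples (Set.mem_Iio.2 k.lt_succ_self)
    rw [tracked_succ]
    exact (measurable_trackedStep hs hL hg xstar a B T k (m k)).comp (h1.prodMk h2)

variable [MeasurableSpace Ω] {μ : Measure Ω} {P : Measure Ξ}

lemma sampleSigma_le (hξ : IsIIDSample μ P ξ) (S : Set ℕ) :
    sampleSigma ξ S ≤ ‹MeasurableSpace Ω› :=
  iSup₂_le fun p _ => (hξ.measurable p.1 p.2).comap_le

lemma indepFun_tracked (hs : IsLSmooth f L) (hL : 0 ≤ L)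
    (hg : Measurable (Function.uncurry g)) (hξ : IsIIDSample μ P ξ) (k : ℕ) :
    IndepFun (tracked f g xstar x0 a L B T m ξ k) (fun ω i => ξ k i ω) μ := by
  have h : Indep (sampleSigma ξ (Set.Iio k)) (sampleSigma ξ {k}) μ := by
    refine indep_iSup_of_disjoint (m := fun p : ℕ × ℕ => MeasurableSpace.comap (ξ p.1 p.2)
      inferInstance) (fun p => (hξ.measurable p.1 p.2).comap_le) hξ.indep.iIndep ?_
    refine Set.disjoint_left.2 fun p hp hp' => ?_
    exact absurd (Set.mem_singleton_iff.1 hp') (Set.mem_Iio.1 hp).ne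
  rw [IndepFun_iff_Indep]
  exact indep_of_indep_of_le_left (indep_of_indep_of_le_right h
    (measurable_samples (Set.mem_singleton k)).comap_le) (measurable_tracked hs hL hg k).comap_le

/-- Conditioning on X, expressed as Tonelli's theorem for the product law: Y is replaced by an
independent copy. -/
lemma lintegral_comp_prodMk_of_indepFun {α β : Type*} [MeasurableSpace α] [MeasurableSpace β]
    [IsProbabilityMeasure μ] {X : Ω → α} {Y : Ω → β} (hX : Measurable X) (hY : Measurable Y)
    (hXY : IndepFun X Y μ) {Φ : α × β → ENNReal} (hΦ : Measurable Φ) :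
    ∫⁻ ω, Φ (X ω, Y ω) ∂μ = ∫⁻ ω, ∫⁻ ω', Φ (X ω, Y ω') ∂μ ∂μ := by
  have : IsProbabilityMeasure (μ.map X) := Measure.isProbabilityMeasure_map hX.aemeasurable
  have : IsProbabilityMeasure (μ.map Y) := Measure.isProbabilityMeasure_map hY.aemeasurable
  rw [← lintegral_map hΦ (hX.prodMk hY),
    (indepFun_iff_map_prod_eq_prod_map_map hX.aemeasurable hY.aemeasurable).1 hXY,
    lintegral_prod _ hΦ.aemeasurable, lintegral_map hΦ.lintegral_prod_right' hX]
  refine lintegral_congr fun ω => ?_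
  exact lintegral_map (hΦ.comp measurable_prodMk_left) hY

lemma measurable_stoppedNoise (hs : IsLSmooth f L) (hL : 0 ≤ L)
    (hg : Measurable (Function.uncurry g)) (hξ : IsIIDSample μ P ξ) (k : ℕ) :
    Measurable fun ω => stoppedNoise f g xstar x0 a L B T m (fun k i => ξ k i ω) k :=
  ((measurable_tracked hs hL hg k).mono (sampleSigma_le hξ _) le_rfl).snd

variable [IsProbabilityMeasure μ] [IsProbabilityMeasure P]

/-- Induction on k: given the past, iteration k multiplies the exponential moment by at most
exp(l/(100N)) if the sum is still active, and by 1 if it is frozen. -/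
lemma lintegral_exp_stoppedNoise_le (hc : ConvexOn ℝ Set.univ f) (hs : IsLSmooth f L)
    (hg : IsStochasticGradient f P g σ) (hξ : IsIIDSample μ P ξ)
    (hmin : IsMinOn f Set.univ xstar) (hL : 0 < L) (ha1 : 1 ≤ a) (hl : 2 ≤ l)
    (ha : 36 * (2 * l + √(4 * l ^ 2 + 2 * l)) ^ 2 ≤ a) (hR : ‖x0 - xstar‖ = R0) (hD : 0 < D)
    (hT : 0 ≤ T) (hDT : R0 ^ 2 + 2 * T ≤ D ^ 2) (hN : 0 < N) (hm : ∀ k, 0 < m k) (k : ℕ)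
    (hvar : ∀ j < k, alpha a L (j + 1) ^ 2 * (σ ^ 2 / m j) ≤ D ^ 2 / (6000 * N * l)) :
    ∫⁻ ω, ENNReal.ofReal (Real.exp (4 * l / D ^ 2 *
        stoppedNoise f g xstar x0 a L (D / (8 * l)) T m (fun k i => ξ k i ω) k)) ∂μ ≤
      ENNReal.ofReal (Real.exp (k * (l / (100 * N)))) := by
  induction k with
  | zero => simp [stoppedNoise]
  | succ k ih =>
    have hX := (measurable_tracked (ξ := ξ) (xstar := xstar) (x0 := x0) (a := a)
      (B := D / (8 * l)) (T := T) (m := m) hs hL.le hg.measurable k).mono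
      (sampleSigma_le hξ _) le_rfl
    have hV : Measurable fun ω i => ξ k i ω := measurable_pi_lambda _ fun i => hξ.measurable k i
    have hΦ : Measurable fun p : ((EuclideanSpace ℝ (Fin n) × EuclideanSpace ℝ (Fin n)) × ℝ) ×
        (ℕ → Ξ) => ENNReal.ofReal (Real.exp (4 * l / D ^ 2 *
          (trackedStep f g xstar a L (D / (8 * l)) T k (m k) p).2)) :=
      (((measurable_trackedStep hs hL.le hg.measurable xstar a _ T k (m k)).snd).const_mul
        _).exp.ennreal_ofReal
    have h1 := lintegral_comp_prodMk_of_indepFun hX hV (indepFun_tracked hs hL.le hg.measurable hξ k)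
      hΦ
    refine le_trans (le_of_eq h1) ?_
    have h2 : ∀ ω, ∫⁻ ω', ENNReal.ofReal (Real.exp (4 * l / D ^ 2 *
        (trackedStep f g xstar a L (D / (8 * l)) T k (m k)
          (tracked f g xstar x0 a L (D / (8 * l)) T m ξ k ω, fun i => ξ k i ω')).2)) ∂μ ≤
        ENNReal.ofReal (Real.exp (4 * l / D ^ 2 *
          stoppedNoise f g xstar x0 a L (D / (8 * l)) T m (fun k i => ξ k i ω) k)) *
        ENNReal.ofReal (Real.exp (l / (100 * N))) := by
      intro ω
      simp only [trackedStep, mul_add, Real.exp_add, ENNReal.ofReal_mul (Real.exp_pos _).le]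
      rw [lintegral_const_mul' _ _ ENNReal.ofReal_ne_top]
      refine mul_le_mul' le_rfl ?_
      by_cases hW : (tracked f g xstar x0 a L (D / (8 * l)) T m ξ k ω).2 ≤ T
      · obtain ⟨h3, h4, h5⟩ := potential_run_le (g := g) (B := D / (8 * l)) (m := m) hc hs hL ha1
          hmin hR hT hD.le hDT k hW
        simp only [if_pos hW]
        refine lintegral_exp_noiseTerm_le hg hξ (hm k) (alpha_succ_pos (by linarith) hL k) hD hl
          hN h5 ?_ (hvar k k.lt_succ_self)
        refine alpha_mul_norm_gradient_le hs hL hmin hl ha k h4 h5 ?_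
        have := sq_nonneg ‖(run g x0 a L (D / (8 * l)) m (fun k i => ξ k i ω) k).z - xstar‖
        have hW' : stoppedNoise f g xstar x0 a L (D / (8 * l)) T m (fun k i => ξ k i ω) k ≤ T := hW
        change bigA a L k * (f (run g x0 a L (D / (8 * l)) m (fun k i => ξ k i ω) k).y - f xstar) ≤ _
        linarith
      · simp only [if_neg hW, mul_zero, Real.exp_zero, lintegral_const, measure_univ, mul_one]
        refine ENNReal.ofReal_le_ofReal (Real.one_le_exp (by positivity))
    refine (lintegral_mono h2).trans ?_
    rw [lintegral_mul_const' _ _ ENNReal.ofReal_ne_top]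
    refine (mul_le_mul_left (ih fun j hj => hvar j (hj.trans k.lt_succ_self)) _).trans_eq ?_
    rw [← ENNReal.ofReal_mul (Real.exp_pos _).le, ← Real.exp_add]
    congr 2
    push_cast
    ring

/-- With high probability the accumulated noise never exceeds its threshold. -/
lemma measureReal_lt_stoppedNoise_le (hc : ConvexOn ℝ Set.univ f) (hs : IsLSmooth f L)
    (hg : IsStochasticGradient f P g σ) (hξ : IsIIDSample μ P ξ)
    (hmin : IsMinOn f Set.univ xstar) (hL : 0 < L) (ha1 : 1 ≤ a) (hl : 2 ≤ l)
    (ha : 36 * (2 * l + √(4 * l ^ 2 + 2 * l)) ^ 2 ≤ a) (hR : ‖x0 - xstar‖ = R0) (hR0 : 0 < R0)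
    (hD : 0 < D) (hDR : D ^ 2 = 5 * R0 ^ 2) {N : ℕ} (hN : 0 < N) (hm : ∀ k, 0 < m k)
    (hvar : ∀ j < N, alpha a L (j + 1) ^ 2 * (σ ^ 2 / m j) ≤ D ^ 2 / (6000 * N * l)) :
    μ.real {ω | 2 * R0 ^ 2 < stoppedNoise f g xstar x0 a L (D / (8 * l)) (2 * R0 ^ 2) m
      (fun k i => ξ k i ω) N} ≤ Real.exp (-l) := by
  have hN' : (0 : ℝ) < N := by exact_mod_cast hN
  have h1 := lintegral_exp_stoppedNoise_le hc hs hg hξ hmin hL ha1 hl ha hR hD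
    (T := 2 * R0 ^ 2) (by positivity) (by linarith) hN' hm N hvar
  have hs0 : 0 < 4 * l / D ^ 2 := by positivity
  set W := fun ω => stoppedNoise f g xstar x0 a L (D / (8 * l)) (2 * R0 ^ 2) m
    (fun k i => ξ k i ω) N with hW
  have hWm : Measurable W := measurable_stoppedNoise hs hL.le hg.measurable hξ N
  have h2 : ENNReal.ofReal (Real.exp (4 * l / D ^ 2 * (2 * R0 ^ 2))) * μ {ω | 2 * R0 ^ 2 < W ω} ≤
      ENNReal.ofReal (Real.exp (N * (l / (100 * N)))) := by
    refine le_trans ?_ h1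
    refine le_trans ?_ (mul_meas_ge_le_lintegral (hWm.const_mul _).exp.ennreal_ofReal
      (ENNReal.ofReal (Real.exp (4 * l / D ^ 2 * (2 * R0 ^ 2)))))
    gcongr with ω
    intro hω
    refine ENNReal.ofReal_le_ofReal (Real.exp_le_exp.2 ?_)
    exact mul_le_mul_of_nonneg_left (le_of_lt hω) hs0.le
  have h3 := ENNReal.toReal_mono ENNReal.ofReal_ne_top h2
  rw [ENNReal.toReal_mul, ENNReal.toReal_ofReal (Real.exp_pos _).le,
    ENNReal.toReal_ofReal (Real.exp_pos _).le] at h3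
  -- Markov's inequality at the threshold leaves the exponent l/100 - 8l/5, which is below -l.
  have e1 : 4 * l / D ^ 2 * (2 * R0 ^ 2) = 8 / 5 * l := by rw [hDR]; field_simp; norm_num
  have e2 : (N : ℝ) * (l / (100 * N)) = l / 100 := by field_simp
  rw [e1, e2] at h3
  have h4 : Real.exp (l / 100) ≤ Real.exp (8 / 5 * l) * Real.exp (-l) := by
    rw [← Real.exp_add]
    exact Real.exp_le_exp.2 (by linarith)
  exact le_of_mul_le_mul_left (h3.trans h4) (Real.exp_pos _)

end

/-! ### The parameters -/

section Parameters

lemma constC_sq : constC ^ 2 = 5 := Real.sq_sqrt (by norm_num)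

lemma constC_pos : 0 < constC := Real.sqrt_pos.2 (by norm_num)

lemma one_le_batchSize (L σ R0 a β : ℝ) (N k : ℕ) : 1 ≤ batchSize L σ R0 a β N k := by
  rw [batchSize, Nat.one_le_ceil_iff]
  exact zero_lt_one.trans_le (le_max_left _ _)

lemma sq_alpha_mul_variance_le {L σ R0 a β : ℝ} {N : ℕ} (hR0 : 0 < R0) (hN : 0 < N)
    (hl : 0 < logFactor N β) (k : ℕ) :
    alpha a L (k + 1) ^ 2 * (σ ^ 2 / batchSize L σ R0 a β N k) ≤
      (constC * R0) ^ 2 / (6000 * N * logFactor N β) := by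
  have hm : (0 : ℝ) < batchSize L σ R0 a β N k := by
    exact_mod_cast one_le_batchSize L σ R0 a β N k
  have h1 : 6000 * σ ^ 2 * alpha a L (k + 1) ^ 2 * (N : ℝ) * logFactor N β /
      (constC ^ 2 * R0 ^ 2) ≤ batchSize L σ R0 a β N k :=
    ((le_max_left _ _).trans (le_max_right _ _)).trans (Nat.le_ceil _)
  have hC : 0 < constC ^ 2 * R0 ^ 2 := by rw [constC_sq]; positivity
  have hN' : (0 : ℝ) < N := by exact_mod_cast hN
  rw [div_le_iff₀ hC] at h1
  rw [← mul_div_assoc, div_le_div_iff₀ hm (by positivity), mul_pow]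
  linarith

/-- The square root is at least 2l, and 36 · (4l)² = 576l². -/
lemma mul_sq_le_aMin {β : ℝ} {N : ℕ} (hl : 0 ≤ logFactor N β) :
    576 * logFactor N β ^ 2 ≤ aMin β N := by
  refine le_trans ?_ ((le_max_right _ _).trans (le_max_right _ _))
  have : 2 * logFactor N β ≤ √(4 * logFactor N β ^ 2 + 2 * logFactor N β) :=
    Real.le_sqrt_of_sq_le (by nlinarith)
  nlinarith

/-- For l ≥ 2 the square root is at most √5 l ≤ 2.24l, and 36 · 4.24² < 650. -/
lemma aMin_le {β : ℝ} {N : ℕ} (hl : 2 ≤ logFactor N β) :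
    aMin β N ≤ 650 * logFactor N β ^ 2 := by
  refine max_le (by nlinarith) (max_le ?_ ?_)
  · rw [div_le_iff₀ constC_pos]
    have : 1 ≤ constC := Real.one_le_sqrt.2 (by norm_num)
    nlinarith [mul_le_mul_of_nonneg_left this (show 0 ≤ 650 * logFactor N β ^ 2 by positivity)]
  · have h1 : √(4 * logFactor N β ^ 2 + 2 * logFactor N β) ≤ 2.24 * logFactor N β :=
      Real.sqrt_le_iff.2 ⟨by linarith, by nlinarith⟩
    have h2 := Real.sqrt_nonneg (4 * logFactor N β ^ 2 + 2 * logFactor N β)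
    have h3 : (2 * logFactor N β + √(4 * logFactor N β ^ 2 + 2 * logFactor N β)) ^ 2 ≤
        (4.24 * logFactor N β) ^ 2 := pow_le_pow_left₀ (by linarith) (by linarith) 2
    nlinarith

/-- The choice of the number of iterations for the complexity bound. -/
lemma exists_iterations {X β : ℝ} (hX : 2 ≤ X) (hβ : 0 < β) (hβ1 : β < 1) :
    ∃ N : ℕ, 1 ≤ N ∧ 2 ≤ logFactor N β ∧ 6500 * logFactor N β ^ 2 * X ≤ (N : ℝ) ^ 2 ∧
      (N : ℝ) ≤ 2048 * (√X * Real.log (X / β)) ∧ Real.log (X / β) ≤ 2 * logFactor N β := by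
  have hX0 : 0 < X := by linarith
  set Λ := Real.log (X / β) with hΛ
  have hexp : Real.exp Λ = X / β := Real.exp_log (by positivity)
  have hXβ : X ≤ X / β := by rw [le_div_iff₀ hβ]; nlinarith
  have hΛ0 : 1 / 2 ≤ Λ := by
    have : Real.log 2 ≤ Λ := Real.log_le_log (by norm_num) (by linarith)
    linarith [Real.log_two_gt_d9]
  have hq2 : √X ^ 2 = X := Real.sq_sqrt hX0.le
  have hq1 : 1 ≤ √X := Real.one_le_sqrt.2 (by linarith)
  set q := √X with hq
  have hqΛ : 1 / 2 ≤ q * Λ := by nlinarith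
  -- Rounding up costs at most 1 ≤ 2qΛ, giving 2048 = 2¹¹; then 4 · 2048 = 2¹³ is absorbed by
  -- e^{13Λ} in the bound l ≤ 15Λ. The constant 2046 also satisfies 6500 · 15² ≤ 2046².
  set N := ⌈2046 * (q * Λ)⌉₊ with hNdef
  have hN1 : 2046 * (q * Λ) ≤ N := Nat.le_ceil _
  have hN2 : (N : ℝ) ≤ 2048 * (q * Λ) := by
    have := (Nat.ceil_lt_add_one (show 0 ≤ 2046 * (q * Λ) by positivity)).le
    linarith
  have hNq : q ≤ N := by nlinarith
  have hN3 : (2 : ℝ) ≤ N := by nlinarith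
  have hN0 : (0 : ℝ) < N := by linarith
  have hpos : 0 < 4 * (N : ℝ) / β := by positivity
  have hN4 : (N : ℝ) ≤ N / β := by rw [le_div_iff₀ hβ]; nlinarith
  have hl2 : 2 ≤ logFactor N β := by
    rw [logFactor, Real.le_log_iff_exp_le hpos]
    have h1 : Real.exp 2 = Real.exp 1 ^ 2 := by rw [← Real.exp_nat_mul]; norm_num
    have h2 := Real.exp_one_lt_d9
    have h3 := Real.exp_pos 1
    have h4 : 4 * (N : ℝ) / β = 4 * (N / β) := by ring
    rw [h1, h4]
    nlinarith
  have hle : logFactor N β ≤ 15 * Λ := by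
    rw [logFactor, Real.log_le_iff_le_exp hpos]
    have h1 : Real.exp (15 * Λ) = Real.exp Λ ^ 13 * Real.exp Λ * Real.exp Λ := by
      rw [← pow_succ, ← pow_succ, ← Real.exp_nat_mul]; norm_num
    have h2 : (2 : ℝ) ^ 13 ≤ Real.exp Λ ^ 13 :=
      pow_le_pow_left₀ (by norm_num) (by rw [hexp]; linarith) 13
    have h3 : q / β ≤ Real.exp Λ := by
      rw [hexp]; exact div_le_div_of_nonneg_right (by nlinarith) hβ.le
    have h4 : Λ ≤ Real.exp Λ := by linarith [Real.add_one_le_exp Λ]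
    rw [h1]
    calc 4 * (N : ℝ) / β ≤ 4 * (2048 * (q * Λ)) / β := by gcongr
      _ = 2 ^ 13 * (q / β) * Λ := by ring
      _ ≤ _ := by gcongr
  -- This lower bound on l is for the oracle count, where l³ stands in a denominator.
  have hge : Λ ≤ 2 * logFactor N β := by
    have h1 : 2 * logFactor N β = Real.log ((4 * (N : ℝ) / β) ^ 2) := by
      rw [Real.log_pow, logFactor]; norm_num
    rw [h1]
    refine Real.log_le_log (by positivity) ?_
    rw [div_pow, div_le_div_iff₀ hβ (by positivity)]
    have h2 : X ≤ (4 * (N : ℝ)) ^ 2 := by nlinarith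
    have h3 : β ^ 2 ≤ β := by nlinarith
    exact mul_le_mul h2 h3 (by positivity) (by positivity)
  refine ⟨N, by exact_mod_cast (by linarith : (1 : ℝ) ≤ N), hl2, ?_, hN2, hge⟩
  have h1 : logFactor N β ^ 2 ≤ (15 * Λ) ^ 2 := pow_le_pow_left₀ (by linarith) hle 2
  calc 6500 * logFactor N β ^ 2 * X ≤ 6500 * (15 * Λ) ^ 2 * X := by gcongr
    _ ≤ (2046 * (q * Λ)) ^ 2 := by
      rw [mul_pow, mul_pow, mul_pow, hq2]
      have : 0 ≤ X * Λ ^ 2 := by positivity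
      nlinarith
    _ ≤ _ := pow_le_pow_left₀ (by positivity) hN1 2

/-- For l ≥ 2 the entry with 6000 dominates the one with 10368, and 6000/C² = 1200. The 2 is the
entry 1 of the maximum plus the rounding. -/
lemma batchSize_le {L σ R0 a β : ℝ} {N : ℕ} (hl : 2 ≤ logFactor N β) (k : ℕ) :
    (batchSize L σ R0 a β N k : ℝ) ≤
      2 + 1200 * (σ ^ 2 * alpha a L (k + 1) ^ 2 * N * logFactor N β / R0 ^ 2) := by
  set t := σ ^ 2 * alpha a L (k + 1) ^ 2 * N / R0 ^ 2 with ht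
  have ht0 : 0 ≤ t := by positivity
  have e1 : 6000 * σ ^ 2 * alpha a L (k + 1) ^ 2 * (N : ℝ) * logFactor N β /
      (constC ^ 2 * R0 ^ 2) = 1200 * (logFactor N β * t) := by
    rw [constC_sq, ht]; ring
  have e2 : 10368 * σ ^ 2 * alpha a L (k + 1) ^ 2 * (N : ℝ) / (constC ^ 2 * R0 ^ 2) =
      10368 / 5 * t := by rw [constC_sq, ht]; ring
  have e3 : σ ^ 2 * alpha a L (k + 1) ^ 2 * N * logFactor N β / R0 ^ 2 = logFactor N β * t := by
    rw [ht]; ring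
  rw [batchSize, e1, e2, e3]
  have h1 : 2 * t ≤ logFactor N β * t := mul_le_mul_of_nonneg_right hl ht0
  refine (Nat.ceil_lt_add_one (zero_le_one.trans (le_max_left _ _))).le.trans ?_
  have : max 1 (max (1200 * (logFactor N β * t)) (10368 / 5 * t)) ≤
      1 + 1200 * (logFactor N β * t) :=
    max_le (by linarith) (max_le (by linarith) (by linarith))
  linarith

/-- Since a ≥ 576l², α_{k+1}² is at most of order N²/(l⁴L²); the factor l in the batch size leaves
l³ in the denominator. -/
lemma oracleCalls_le {L σ R0 β : ℝ} {N : ℕ} (hL : 0 < L) (hN : 1 ≤ N)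
    (hl : 2 ≤ logFactor N β) :
    (oracleCalls (batchSize L σ R0 (aMin β N) β N) N : ℝ) ≤
      2 * N + σ ^ 2 * (N : ℝ) ^ 4 / (logFactor N β ^ 3 * L ^ 2 * R0 ^ 2) := by
  set l := logFactor N β with hldef
  have hl0 : 0 < l := by linarith
  have hN1 : (1 : ℝ) ≤ N := by exact_mod_cast hN
  have ha : 576 * l ^ 2 ≤ aMin β N := mul_sq_le_aMin hl0.le
  have ha0 : 0 < aMin β N := lt_of_lt_of_le (by positivity) ha
  have hα : ∀ k < N, alpha (aMin β N) L (k + 1) ^ 2 ≤ ((N : ℝ) / (576 * l ^ 2 * L)) ^ 2 := by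
    intro k hk
    have hk' : (k : ℝ) + 1 ≤ N := by exact_mod_cast hk
    refine pow_le_pow_left₀ (alpha_succ_pos ha0 hL k).le ?_ 2
    rw [alpha]
    calc ((k : ℝ) + 2) / (2 * aMin β N * L) ≤ (2 * N) / (2 * (576 * l ^ 2) * L) := by
          gcongr
          linarith
      _ = _ := by field_simp
  rw [oracleCalls, Nat.cast_sum]
  calc ∑ k ∈ Finset.range N, (batchSize L σ R0 (aMin β N) β N k : ℝ)
      ≤ ∑ k ∈ Finset.range N, (2 + 1200 * (σ ^ 2 * ((N : ℝ) / (576 * l ^ 2 * L)) ^ 2 * N * l /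
          R0 ^ 2)) := by
        refine Finset.sum_le_sum fun k hk => (batchSize_le hl k).trans ?_
        have := hα k (Finset.mem_range.1 hk)
        gcongr
    _ = 2 * N + 1200 / 576 ^ 2 * (σ ^ 2 * (N : ℝ) ^ 4 / (l ^ 3 * L ^ 2 * R0 ^ 2)) := by
        rw [Finset.sum_const, Finset.card_range, nsmul_eq_mul]
        rcases eq_or_ne R0 0 with rfl | hR0
        · simp; ring
        · field_simp
    _ ≤ _ := by
        have : 0 ≤ σ ^ 2 * (N : ℝ) ^ 4 / (l ^ 3 * L ^ 2 * R0 ^ 2) := by positivity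
        linarith

end Parameters

/-- The high-probability bound for clipped-SSTM. -/
lemma le_measureReal_output_gap_le {n : ℕ} {Ω Ξ : Type*} [MeasurableSpace Ω] [MeasurableSpace Ξ]
    {μ : Measure Ω} {P : Measure Ξ} [IsProbabilityMeasure P] [IsProbabilityMeasure μ]
    {f : EuclideanSpace ℝ (Fin n) → ℝ}
    {g : EuclideanSpace ℝ (Fin n) → Ξ → EuclideanSpace ℝ (Fin n)} {ξ : ℕ → ℕ → Ω → Ξ}
    {x0 xstar : EuclideanSpace ℝ (Fin n)} {L σ R0 a β : ℝ} {N : ℕ}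
    (hL : 0 < L) (hβ : 0 < β) (hN : 1 ≤ N) (hl : 2 ≤ logFactor N β)
    (hc : ConvexOn ℝ Set.univ f) (hs : IsLSmooth f L) (hg : IsStochasticGradient f P g σ)
    (hξ : IsIIDSample μ P ξ) (hmin : IsMinOn f Set.univ xstar) (hR : ‖x0 - xstar‖ = R0)
    (hR0 : 0 < R0) (ha : aMin β N ≤ a) :
    1 - β ≤ μ.real {ω | f (output g x0 L σ R0 a β N (fun k i => ξ k i ω)) - f xstar ≤
      2 * a * L * constC ^ 2 * R0 ^ 2 / ((N : ℝ) * ((N : ℝ) + 3))} := by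
  have hN' : (1 : ℝ) ≤ N := by exact_mod_cast hN
  have ha1 : 1 ≤ a := (le_max_left _ _).trans ha
  have ha0 : 0 < a := by linarith
  have ha2 := ((le_max_right _ _).trans (le_max_right _ _)).trans ha
  have hD : 0 < constC * R0 := mul_pos constC_pos hR0
  have hDR : (constC * R0) ^ 2 = 5 * R0 ^ 2 := by rw [mul_pow, constC_sq]
  have hm := fun k => one_le_batchSize L σ R0 a β N k
  have hbad := measureReal_lt_stoppedNoise_le hc hs hg hξ hmin hL ha1 hl ha2 hR hR0 hD hDR hN hm
    fun k _ => sq_alpha_mul_variance_le hR0 hN (by linarith) k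
  have hexp : Real.exp (-logFactor N β) ≤ β := by
    rw [Real.exp_neg, logFactor, Real.exp_log (by positivity), inv_div, div_le_iff₀ (by positivity)]
    nlinarith
  set W := fun ω => stoppedNoise f g xstar x0 a L (constC * R0 / (8 * logFactor N β)) (2 * R0 ^ 2)
    (batchSize L σ R0 a β N) (fun k i => ξ k i ω) N with hW
  have hWm : Measurable W := measurable_stoppedNoise hs hL.le hg.measurable hξ N
  have hmeas : MeasurableSet {ω | 2 * R0 ^ 2 < W ω} := measurableSet_lt measurable_const hWm
  have hcompl := probReal_compl_eq_one_sub (μ := μ) hmeas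
  have hsub : {ω | 2 * R0 ^ 2 < W ω}ᶜ ⊆ {ω | f (output g x0 L σ R0 a β N (fun k i => ξ k i ω)) -
      f xstar ≤ 2 * a * L * constC ^ 2 * R0 ^ 2 / ((N : ℝ) * ((N : ℝ) + 3))} := by
    intro ω hω
    have hω' : W ω ≤ 2 * R0 ^ 2 := not_lt.1 hω
    obtain ⟨h1, -, -⟩ := potential_run_le hc hs hL ha1 hmin hR (by positivity) hD.le
      (by rw [hDR]; linarith) N hω'
    rw [bigA_eq] at h1
    have h2 : (N : ℝ) * (N + 3) / (4 * a * L) *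
        (f (output g x0 L σ R0 a β N (fun k i => ξ k i ω)) - f xstar) ≤ 5 * R0 ^ 2 / 2 := by
      change (_ : ℝ) ≤ _ + W ω at h1
      have := sq_nonneg ‖(run g x0 a L (constC * R0 / (8 * logFactor N β)) (batchSize L σ R0 a β N)
        (fun k i => ξ k i ω) N).z - xstar‖
      change (N : ℝ) * (N + 3) / (4 * a * L) * (f (run g x0 a L (constC * R0 / (8 * logFactor N β))
        (batchSize L σ R0 a β N) (fun k i => ξ k i ω) N).y - f xstar) ≤ _
      linarith
    rw [Set.mem_ofPred_eq, constC_sq, le_div_iff₀ (by positivity)]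
    rw [div_mul_eq_mul_div, div_le_iff₀ (by positivity)] at h2
    linarith
  have := measureReal_mono (μ := μ) hsub
  linarith

end ClippedSSTM

theorem mainTheorem1 :
    -- the high-probability bound, for every admissible `a`
    (∀ (n : ℕ) (Ξ : Type*) (Ω : Type*) [MeasurableSpace Ξ] [MeasurableSpace Ω]
        (P : Measure Ξ) (μ : Measure Ω) [IsProbabilityMeasure P] [IsProbabilityMeasure μ]
        (f : EuclideanSpace ℝ (Fin n) → ℝ)
        (g : EuclideanSpace ℝ (Fin n) → Ξ → EuclideanSpace ℝ (Fin n))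
        (ξ : ℕ → ℕ → Ω → Ξ) (x0 xstar : EuclideanSpace ℝ (Fin n))
        (L σ R0 a β : ℝ) (N : ℕ),
      0 < L → 0 ≤ σ → 0 < β → β < 1 → 1 ≤ N → 2 ≤ Real.log (4 * (N : ℝ) / β) →
      ConvexOn ℝ Set.univ f →
      ClippedSSTM.IsLSmooth f L →
      ClippedSSTM.IsStochasticGradient f P g σ →
      ClippedSSTM.IsIIDSample μ P ξ →
      IsMinOn f Set.univ xstar →
      ‖x0 - xstar‖ = R0 → 0 < R0 →
      ClippedSSTM.aMin β N ≤ a →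
      1 - β ≤ μ.real {ω |
        f (ClippedSSTM.output g x0 L σ R0 a β N (fun k i => ξ k i ω)) - f xstar
          ≤ 2 * a * L * ClippedSSTM.constC ^ 2 * R0 ^ 2 / ((N : ℝ) * ((N : ℝ) + 3))}) ∧
    -- the iteration and oracle complexity, with `a` equal to the threshold
    (∃ K : ℝ, 0 < K ∧ ∀ L σ R0 ε β : ℝ,
      0 < L → 0 ≤ σ → 0 < R0 → 0 < β → β < 1 → 0 < ε → ε ≤ L * R0 ^ 2 / 2 →
      ∃ N : ℕ, 1 ≤ N ∧ 2 ≤ Real.log (4 * (N : ℝ) / β) ∧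
        (N : ℝ) ≤ K * (√(L * R0 ^ 2 / ε) * Real.log (L * R0 ^ 2 / (ε * β))) ∧
        (ClippedSSTM.oracleCalls
            (ClippedSSTM.batchSize L σ R0 (ClippedSSTM.aMin β N) β N) N : ℝ)
          ≤ K * (max (√(L * R0 ^ 2 / ε)) (σ ^ 2 * R0 ^ 2 / ε ^ 2)
              * Real.log (L * R0 ^ 2 / (ε * β))) ∧
        ∀ (n : ℕ) (Ξ : Type*) (Ω : Type*) [MeasurableSpace Ξ] [MeasurableSpace Ω]
          (P : Measure Ξ) (μ : Measure Ω) [IsProbabilityMeasure P] [IsProbabilityMeasure μ]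
          (f : EuclideanSpace ℝ (Fin n) → ℝ)
          (g : EuclideanSpace ℝ (Fin n) → Ξ → EuclideanSpace ℝ (Fin n))
          (ξ : ℕ → ℕ → Ω → Ξ) (x0 xstar : EuclideanSpace ℝ (Fin n)),
          ConvexOn ℝ Set.univ f →
          ClippedSSTM.IsLSmooth f L →
          ClippedSSTM.IsStochasticGradient f P g σ →
          ClippedSSTM.IsIIDSample μ P ξ →
          IsMinOn f Set.univ xstar →
          ‖x0 - xstar‖ = R0 →
          1 - β ≤ μ.real {ω |
            f (ClippedSSTM.output g x0 L σ R0 (ClippedSSTM.aMin β N) β N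
                (fun k i => ξ k i ω)) - f xstar ≤ ε}) := by
  -- The oracle count sets the constant: 8 · 2048⁴ = 2⁴⁷ for the variance part plus 2 · 2048 = 2¹²
  -- for the part linear in N.
  refine ⟨?_, 2 ^ 48, by norm_num, ?_⟩
  · intro n Ξ Ω _ _ P μ _ _ f g ξ x0 xstar L σ R0 a β N hL _ hβ _ hN hl hc hs hg hξ hmin hR hR0 ha
    exact ClippedSSTM.le_measureReal_output_gap_le hL hβ hN hl hc hs hg hξ hmin hR hR0 ha
  · intro L σ R0 ε β hL _ hR0 hβ hβ1 hε hεL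
    have hX : 2 ≤ L * R0 ^ 2 / ε := by rw [le_div_iff₀ hε]; linarith
    have hXβ : L * R0 ^ 2 / (ε * β) = L * R0 ^ 2 / ε / β := by rw [div_div]
    obtain ⟨N, hN, hl, hNl, hNX, hΛ⟩ := ClippedSSTM.exists_iterations hX hβ hβ1
    rw [hXβ]
    set Λ := Real.log (L * R0 ^ 2 / ε / β) with hΛdef
    have hΛ0 : 0 < Λ := Real.log_pos (by rw [one_lt_div hβ]; linarith)
    have hN' : (1 : ℝ) ≤ N := by exact_mod_cast hN
    have hsq : √(L * R0 ^ 2 / ε) ^ 2 = L * R0 ^ 2 / ε := Real.sq_sqrt (by linarith)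
    have hq0 := Real.sqrt_nonneg (L * R0 ^ 2 / ε)
    refine ⟨N, hN, hl, ?_, ?_, ?_⟩
    · refine hNX.trans (mul_le_mul_of_nonneg_right (by norm_num) (by positivity))
    · refine (ClippedSSTM.oracleCalls_le hL hN hl).trans ?_
      have h1 : (N : ℝ) ^ 4 ≤ 2048 ^ 4 * (L * R0 ^ 2 / ε) ^ 2 * Λ ^ 4 := by
        calc (N : ℝ) ^ 4 ≤ (2048 * (√(L * R0 ^ 2 / ε) * Λ)) ^ 4 :=
              pow_le_pow_left₀ (by positivity) hNX 4
          _ = 2048 ^ 4 * (√(L * R0 ^ 2 / ε) ^ 2) ^ 2 * Λ ^ 4 := by ring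
          _ = _ := by rw [hsq]
      have h2 : (Λ / 2) ^ 3 ≤ ClippedSSTM.logFactor N β ^ 3 :=
        pow_le_pow_left₀ (by positivity) (by linarith) 3
      have h3 : σ ^ 2 * (N : ℝ) ^ 4 / (ClippedSSTM.logFactor N β ^ 3 * L ^ 2 * R0 ^ 2) ≤
          8 * 2048 ^ 4 * (σ ^ 2 * R0 ^ 2 / ε ^ 2 * Λ) := by
        calc _ ≤ σ ^ 2 * (2048 ^ 4 * (L * R0 ^ 2 / ε) ^ 2 * Λ ^ 4) /
              ((Λ / 2) ^ 3 * L ^ 2 * R0 ^ 2) := by gcongr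
          _ = _ := by field_simp; ring
      have h4 := mul_le_mul_of_nonneg_right
        (le_max_left (√(L * R0 ^ 2 / ε)) (σ ^ 2 * R0 ^ 2 / ε ^ 2)) hΛ0.le
      have h5 := mul_le_mul_of_nonneg_right
        (le_max_right (√(L * R0 ^ 2 / ε)) (σ ^ 2 * R0 ^ 2 / ε ^ 2)) hΛ0.le
      have h6 : 0 ≤ √(L * R0 ^ 2 / ε) * Λ := by positivity
      linarith
    · intro n Ξ Ω _ _ P μ _ _ f g ξ x0 xstar hc hs hg hξ hmin hR
      refine (ClippedSSTM.le_measureReal_output_gap_le hL hβ hN hl hc hs hg hξ hmin hR hR0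
        le_rfl).trans (measureReal_mono fun ω hω => ?_)
      rw [Set.mem_ofPred_eq] at hω ⊢
      refine hω.trans ?_
      rw [ClippedSSTM.constC_sq, div_le_iff₀ (by positivity)]
      -- With a ≤ 650l² and C² = 5 the numerator 2aLC²R₀² is at most 6500l²LR₀², the quantity that
      -- the choice of N bounds by εN².
      have h1 := mul_le_mul_of_nonneg_right (ClippedSSTM.aMin_le hl)
        (show 0 ≤ 10 * (L * R0 ^ 2) by positivity)
      rw [mul_div_assoc', div_le_iff₀ hε] at hNl
      have h2 : 0 ≤ ε * (3 * N) := by positivity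
      linarith
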